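/- Let $K$ be an algebraically closed field of characteristic $2$. Let $\mathcal Q$ be the quiver with vertices $1,2,3,4$ and arrows $\alpha:1\to 4$, $\beta:4\to 1$, $\gamma:3\to 4$, $\delta:4\to 3$, $\xi:2\to 4$, $\epsilon:4\to 2$. Let $\mathcal A_1=K\mathcal Q/I$ be the preprojective algebra of type $D_4$, where $I$ is the two-sided ideal of the path algebra $K\mathcal Q$ (paths written from left to right) generated by $$\alpha\beta,\qquad \xi\epsilon,\qquad \gamma\delta,\qquad \beta\alpha+\delta\gamma+\epsilon\xi .$$ Then the second Hochschild cohomology group $\mathrm{HH}^2(\mathcal A_1)$ of $\mathcal A_1$ with coefficients in $\mathcal A_1$ satisfies $$\dim_K \mathrm{HH}^2(\mathcal A_1)=3 .$$ -/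

import Mathlib

universe u v w

/-! ### Path algebras of finite quivers -/

/-- Generators of a path algebra: the trivial path `e x` at every vertex `x`, and every arrow. -/
inductive PathAlgebraGen (V : Type v) [Quiver.{w} V] : Type (max v w)
  | vertex (x : V) : PathAlgebraGen V
  | arrow {x y : V} (a : x ⟶ y) : PathAlgebraGen V

/-- The defining relations of the path algebra: the trivial paths are orthogonal idempotents with
sum `1`, and an arrow `a : x ⟶ y` satisfies `e x * a = a = a * e y`. Products of arrows are thus
paths written from left to right, and a product of arrows that cannot be composed vanishes. -/
inductive PathAlgebraRel (K : Type u) [Field K] (V : Type v) [Fintype V] [Quiver.{w} V] :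
    FreeAlgebra K (PathAlgebraGen V) → FreeAlgebra K (PathAlgebraGen V) → Prop
  | idem (x : V) : PathAlgebraRel K V
      (FreeAlgebra.ι K (.vertex x) * FreeAlgebra.ι K (.vertex x)) (FreeAlgebra.ι K (.vertex x))
  | orth (x y : V) (h : x ≠ y) : PathAlgebraRel K V
      (FreeAlgebra.ι K (.vertex x) * FreeAlgebra.ι K (.vertex y)) 0
  | sum_eq_one : PathAlgebraRel K V (∑ x : V, FreeAlgebra.ι K (.vertex x)) 1
  | origin {x y : V} (a : x ⟶ y) : PathAlgebraRel K V
      (FreeAlgebra.ι K (.vertex x) * FreeAlgebra.ι K (.arrow a)) (FreeAlgebra.ι K (.arrow a))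
  | terminus {x y : V} (a : x ⟶ y) : PathAlgebraRel K V
      (FreeAlgebra.ι K (.arrow a) * FreeAlgebra.ι K (.vertex y)) (FreeAlgebra.ι K (.arrow a))

/-- The path algebra `K𝒬` of a quiver with finite vertex set `V`. -/
def PathAlgebra (K : Type u) [Field K] (V : Type v) [Fintype V] [Quiver.{w} V] :
    Type (max u v w) :=
  RingQuot (PathAlgebraRel K V)

noncomputable instance (K : Type u) [Field K] (V : Type v) [Fintype V] [Quiver.{w} V] :
    Ring (PathAlgebra K V) :=
  inferInstanceAs (Ring (RingQuot (PathAlgebraRel K V)))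

noncomputable instance (K : Type u) [Field K] (V : Type v) [Fintype V] [Quiver.{w} V] :
    Algebra K (PathAlgebra K V) :=
  inferInstanceAs (Algebra K (RingQuot (PathAlgebraRel K V)))

/-- The canonical projection from the free algebra to the path algebra. -/
noncomputable def PathAlgebra.mk (K : Type u) [Field K] (V : Type v) [Fintype V] [Quiver.{w} V] :
    FreeAlgebra K (PathAlgebraGen V) →ₐ[K] PathAlgebra K V :=
  RingQuot.mkAlgHom K (PathAlgebraRel K V)

/-- An arrow as an element of the path algebra. -/
noncomputable def PathAlgebra.arrow (K : Type u) [Field K] {V : Type v} [Fintype V] [Quiver.{w} V]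
    {x y : V} (a : x ⟶ y) : PathAlgebra K V :=
  PathAlgebra.mk K V (FreeAlgebra.ι K (.arrow a))

/-! ### The preprojective algebra of type `D₄` -/

/-- The vertices of the double quiver of `D₄`; `v4` is the branch vertex. -/
inductive D4Vertex : Type
  | v1 | v2 | v3 | v4
  deriving DecidableEq

instance : Fintype D4Vertex :=
  ⟨{.v1, .v2, .v3, .v4}, by rintro ⟨⟩ <;> decide⟩

/-- The arrows of the double quiver of `D₄`. -/
inductive D4Arrow : D4Vertex → D4Vertex → Type
  | α : D4Arrow .v1 .v4
  | β : D4Arrow .v4 .v1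
  | γ : D4Arrow .v3 .v4
  | δ : D4Arrow .v4 .v3
  | ε : D4Arrow .v4 .v2
  | ξ : D4Arrow .v2 .v4

instance : Quiver.{0} D4Vertex := ⟨D4Arrow⟩

/-- The six arrows as elements of the path algebra of the double quiver of `D₄`. -/
noncomputable def d4Arrow (K : Type u) [Field K] {x y : D4Vertex} (a : D4Arrow x y) :
    PathAlgebra K D4Vertex :=
  PathAlgebra.arrow K (V := D4Vertex) (x := x) (y := y) a

/-- The relations `αβ = 0`, `ξε = 0`, `γδ = 0` and `βα + δγ + εξ = 0`. -/
inductive PreprojectiveD4Rel (K : Type u) [Field K] :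
    PathAlgebra K D4Vertex → PathAlgebra K D4Vertex → Prop
  | rel1 : PreprojectiveD4Rel K (d4Arrow K .α * d4Arrow K .β) 0
  | rel2 : PreprojectiveD4Rel K (d4Arrow K .ξ * d4Arrow K .ε) 0
  | rel3 : PreprojectiveD4Rel K (d4Arrow K .γ * d4Arrow K .δ) 0
  | rel4 : PreprojectiveD4Rel K
      (d4Arrow K .β * d4Arrow K .α + d4Arrow K .δ * d4Arrow K .γ + d4Arrow K .ε * d4Arrow K .ξ) 0

/-- The preprojective algebra of type `D₄`: the quotient of the path algebra by the two-sided ideal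
generated by the relations. -/
def PreprojectiveD4 (K : Type u) [Field K] : Type u :=
  RingQuot (PreprojectiveD4Rel K)

noncomputable instance (K : Type u) [Field K] : Ring (PreprojectiveD4 K) :=
  inferInstanceAs (Ring (RingQuot (PreprojectiveD4Rel K)))

noncomputable instance (K : Type u) [Field K] : Algebra K (PreprojectiveD4 K) :=
  inferInstanceAs (Algebra K (RingQuot (PreprojectiveD4Rel K)))

/-! ### Second Hochschild cohomology -/

/-- The quotient `Z / B` for submodules `B ⊆ Z` of a module `N` (in general `Z / (B ∩ Z)`). -/
abbrev Subquotient {K : Type u} {N : Type v} [Ring K] [AddCommGroup N] [Module K N]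
    (Z B : Submodule K N) : Type v :=
  Z ⧸ B.submoduleOf Z

section Hochschild

open scoped TensorProduct

variable (K : Type u) [Field K] (A : Type v) [Ring A] [Algebra K A]

/-- The Hochschild differential `C¹(A, A) → C²(A, A)`, where `Cⁿ(A, A) = Hom_K(A^{⊗ n}, A)`,
`(δ f)(a ⊗ b) = a f(b) - f(ab) + f(a) b`. -/
noncomputable def hochschildD1 : (A →ₗ[K] A) →ₗ[K] (A ⊗[K] A →ₗ[K] A) where
  toFun f := LinearMap.mul' K A ∘ₗ f.lTensor A - f ∘ₗ LinearMap.mul' K A +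
    LinearMap.mul' K A ∘ₗ f.rTensor A
  map_add' f g := by
    ext a b
    simp only [TensorProduct.AlgebraTensorModule.curry_apply, LinearMap.restrictScalars_self, TensorProduct.curry_apply, LinearMap.add_apply, LinearMap.sub_apply, LinearMap.comp_apply, LinearMap.lTensor_tmul, LinearMap.rTensor_tmul, LinearMap.mul'_apply, mul_add, add_mul]
    abel
  map_smul' c f := by
    ext a b
    simp [smul_add, smul_sub]

@[simp]
theorem hochschildD1_apply (f : A →ₗ[K] A) (a b : A) :
    hochschildD1 K A f (a ⊗ₜ[K] b) = a * f b - f (a * b) + f a * b := by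
  simp [hochschildD1]

/-- Hochschild 2-cocycles: the kernel of the Hochschild differential `C²(A, A) → C³(A, A)`,
`(δ f)(a ⊗ b ⊗ c) = a f(b ⊗ c) - f(ab ⊗ c) + f(a ⊗ bc) - f(a ⊗ b) c`. -/
def hochschildZ2 : Submodule K (A ⊗[K] A →ₗ[K] A) where
  carrier := {f | ∀ a b c : A, a * f (b ⊗ₜ[K] c) - f ((a * b) ⊗ₜ[K] c) +
    f (a ⊗ₜ[K] (b * c)) - f (a ⊗ₜ[K] b) * c = 0}
  add_mem' {f g} hf hg a b c := by
    have h := congrArg₂ (· + ·) (hf a b c) (hg a b c)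
    simp only [add_zero] at h
    rw [← h]
    simp only [LinearMap.add_apply, mul_add, add_mul]; abel
  zero_mem' a b c := by simp
  smul_mem' r f hf a b c := by
    have h := congrArg (r • ·) (hf a b c)
    simp only [smul_zero] at h
    rw [← h]
    simp only [LinearMap.smul_apply, mul_smul_comm, smul_mul_assoc, smul_add, smul_sub]

/-- Hochschild 2-coboundaries. -/
noncomputable def hochschildB2 : Submodule K (A ⊗[K] A →ₗ[K] A) :=
  LinearMap.range (hochschildD1 K A)

theorem hochschildB2_le_Z2 : hochschildB2 K A ≤ hochschildZ2 K A := by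
  rintro _ ⟨f, rfl⟩ a b c
  simp only [hochschildD1_apply, mul_add, mul_sub, add_mul, sub_mul, mul_assoc]
  abel

/-- The second Hochschild cohomology group `HH²(A) = Z²(A, A) / B²(A, A)`; as `K` is a field, it is
`Ext²(A, A)` over the enveloping algebra of `A`. -/
abbrev HH2 : Type v :=
  Subquotient (hochschildZ2 K A) (hochschildB2 K A)

end Hochschild

/-! Write A for the algebra. A 2-cocycle defines a square-zero extension of A by A, and its class
measures how far lifts of the six arrows fail to satisfy the relations. After normalization at the
trivial paths, the defects of αβ, ξε, γδ lie in the corners at vertices 1, 2, 3 and have the form lᵢ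
eᵢ + sᵢ · (path of length 4). The defect of the branch relation is l₄ e₄ + p βα + q δγ + s₄ βαδγ.

Expanding α(εξ)²β and γ(εξ)²δ with the branch relation forces l₁ = l₂ = l₃ in characteristic 2
(`defect_identity`). Changing the lifts of the arrows absorbs p, q and all the sᵢ up to their sum.
What remains is l₁, l₄ and s₁ + s₂ + s₃ + s₄, which the map `invariants` from cochains to K³
records. It kills coboundaries: characters vanish on products with an arrow, and the form `tr`
satisfies tr(ab) = tr(ba) for arrows a, so every term produced by a change of lifts occurs twice
(`invariants_hochschildD1`). Conversely, when the invariants vanish, corrected lifts satisfy the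
relations, the extension splits and the cocycle is a coboundary (`mem_hochschildB2_of_normalized`).

For surjectivity, A is embedded in B, the 28 × 28 matrices, by the left regular representation.
Matrices deforming the arrows to first order with defects in A give a derivation A → B/A, and the
connecting map HH¹(A, B/A) → HH²(A, A) turns it into a cocycle with these defects
(`exists_cocycle`). Three explicit deformations realize the unit vectors of K³. -/

open scoped TensorProduct

/-! ### Universal property of the preprojective algebra -/

namespace PreprojectiveD4

/-- Elements of a ring satisfying the defining relations of the preprojective algebra of type
`D₄`. -/
structure Rep (B : Type v) [Ring B] where
  e : D4Vertex → B
  a : ∀ {x y : D4Vertex}, D4Arrow x y → B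
  idem (x : D4Vertex) : e x * e x = e x
  orth (x y : D4Vertex) : x ≠ y → e x * e y = 0
  sum_eq_one : ∑ x, e x = 1
  origin {x y : D4Vertex} (f : D4Arrow x y) : e x * a f = a f
  terminus {x y : D4Vertex} (f : D4Arrow x y) : a f * e y = a f
  rel1 : a .α * a .β = 0
  rel2 : a .ξ * a .ε = 0
  rel3 : a .γ * a .δ = 0
  rel4 : a .β * a .α + a .δ * a .γ + a .ε * a .ξ = 0

/-- The generators of the path algebra of the double quiver of `D₄`. -/
abbrev Gen : Type := PathAlgebraGen D4Vertex

variable {K : Type u} [Field K]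

/-- The canonical projection from the path algebra. -/
noncomputable def proj (K : Type u) [Field K] : PathAlgebra K D4Vertex →ₐ[K] PreprojectiveD4 K :=
  RingQuot.mkAlgHom K (PreprojectiveD4Rel K)

theorem pathAlgebra_mk_eq {V : Type v} [Fintype V] [Quiver.{w} V]
    {p q : FreeAlgebra K (PathAlgebraGen V)} (h : PathAlgebraRel K V p q) :
    PathAlgebra.mk K V p = PathAlgebra.mk K V q :=
  RingQuot.mkAlgHom_rel K h

theorem proj_eq {p q : PathAlgebra K D4Vertex} (h : PreprojectiveD4Rel K p q) :
    proj K p = proj K q :=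
  RingQuot.mkAlgHom_rel K h

/-- The tautological elements of the preprojective algebra. -/
noncomputable def univ (K : Type u) [Field K] : Rep (PreprojectiveD4 K) where
  e x := proj K (PathAlgebra.mk K D4Vertex (FreeAlgebra.ι K (.vertex x)))
  a f := proj K (d4Arrow K f)
  idem x := by rw [← map_mul, ← map_mul, pathAlgebra_mk_eq (.idem x)]
  orth x y h := by rw [← map_mul, ← map_mul, pathAlgebra_mk_eq (.orth x y h), map_zero, map_zero]
  sum_eq_one := by
    rw [← map_sum, ← map_sum, pathAlgebra_mk_eq .sum_eq_one, map_one, map_one]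
  origin {x y} f := by
    rw [d4Arrow, PathAlgebra.arrow, ← map_mul, ← map_mul]
    exact congrArg _ (pathAlgebra_mk_eq (V := D4Vertex) (.origin (x := x) (y := y) f))
  terminus {x y} f := by
    rw [d4Arrow, PathAlgebra.arrow, ← map_mul, ← map_mul]
    exact congrArg _ (pathAlgebra_mk_eq (V := D4Vertex) (.terminus (x := x) (y := y) f))
  rel1 := by rw [← map_mul, proj_eq .rel1, map_zero]
  rel2 := by rw [← map_mul, proj_eq .rel2, map_zero]
  rel3 := by rw [← map_mul, proj_eq .rel3, map_zero]
  rel4 := by simp only [← map_mul, ← map_add, proj_eq .rel4, map_zero]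

namespace Rep

variable {B : Type v} [Ring B] (R : Rep B)

/-- The image of a generator. -/
def gen : Gen → B
  | .vertex x => R.e x
  | .arrow f => R.a f

section lift

variable [Algebra K B]

/-- The algebra homomorphism from the path algebra. -/
noncomputable def pathLift : PathAlgebra K D4Vertex →ₐ[K] B :=
  RingQuot.liftAlgHom K ⟨FreeAlgebra.lift K R.gen, by
    intro p q h
    cases h with
    | idem x => simpa [gen] using R.idem x
    | orth x y h => simpa [gen] using R.orth x y h
    | sum_eq_one => simpa [gen] using R.sum_eq_one
    | origin f => simpa [gen] using R.origin f
    | terminus f => simpa [gen] using R.terminus f⟩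

theorem pathLift_mk (p : FreeAlgebra K (PathAlgebraGen D4Vertex)) :
    R.pathLift (PathAlgebra.mk K D4Vertex p) = FreeAlgebra.lift K R.gen p :=
  RingQuot.liftAlgHom_mkAlgHom_apply _ _ _ _

theorem pathLift_arrow {x y : D4Vertex} (f : D4Arrow x y) :
    R.pathLift (d4Arrow K f) = R.a f := by
  rw [d4Arrow, PathAlgebra.arrow, pathLift_mk, FreeAlgebra.lift_ι_apply]; rfl

/-- The universal property of the preprojective algebra. -/
noncomputable def lift : PreprojectiveD4 K →ₐ[K] B :=
  RingQuot.liftAlgHom K ⟨R.pathLift, by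
    intro p q h
    cases h with
    | rel1 => simpa [pathLift_arrow] using R.rel1
    | rel2 => simpa [pathLift_arrow] using R.rel2
    | rel3 => simpa [pathLift_arrow] using R.rel3
    | rel4 => simpa [pathLift_arrow] using R.rel4⟩

theorem lift_proj (p : PathAlgebra K D4Vertex) : R.lift (proj K p) = R.pathLift p :=
  RingQuot.liftAlgHom_mkAlgHom_apply _ _ _ _

@[simp]
theorem lift_e (x : D4Vertex) : R.lift ((univ K).e x) = R.e x := by
  simp only [univ, lift_proj, pathLift_mk, FreeAlgebra.lift_ι_apply]; rfl

@[simp]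
theorem lift_a {x y : D4Vertex} (f : D4Arrow x y) : R.lift ((univ K).a f) = R.a f := by
  simp only [univ, lift_proj, pathLift_arrow]

@[simp]
theorem lift_gen (g : Gen) : R.lift ((univ K).gen g) = R.gen g := by
  cases g with
  | vertex x => exact R.lift_e x
  | arrow f => exact R.lift_a f

end lift

theorem e_mul_e (x y : D4Vertex) : R.e x * R.e y = if x = y then R.e x else 0 := by
  split_ifs with h
  · rw [h, R.idem]
  · exact R.orth x y h

theorem e_mul_a (x : D4Vertex) {y z : D4Vertex} (f : D4Arrow y z) :
    R.e x * R.a f = if x = y then R.a f else 0 := by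
  rw [← R.origin f, ← mul_assoc, e_mul_e]
  split_ifs with h <;> simp [h]

theorem a_mul_e {y z : D4Vertex} (f : D4Arrow y z) (x : D4Vertex) :
    R.a f * R.e x = if z = x then R.a f else 0 := by
  rw [← R.terminus f, mul_assoc, e_mul_e]
  split_ifs with h <;> simp

theorem a_mul_a_eq_zero {x y z w : D4Vertex} (f : D4Arrow x y) (g : D4Arrow z w) (h : y ≠ z) :
    R.a f * R.a g = 0 := by
  rw [← R.terminus f, mul_assoc, e_mul_a, if_neg h, mul_zero]

theorem e_mul_a_mul (x : D4Vertex) {y z : D4Vertex} (f : D4Arrow y z) (t : B) :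
    R.e x * (R.a f * t) = if x = y then R.a f * t else 0 := by
  rw [← mul_assoc, e_mul_a]; split_ifs <;> simp

theorem a_mul_a_mul_eq_zero {x y z w : D4Vertex} (f : D4Arrow x y) (g : D4Arrow z w) (h : y ≠ z)
    (t : B) : R.a f * (R.a g * t) = 0 := by
  rw [← mul_assoc, a_mul_a_eq_zero R f g h, zero_mul]

end Rep

/-- The preprojective algebra is generated by the trivial paths and the arrows. -/
theorem induction {P : PreprojectiveD4 K → Prop}
    (algebraMap : ∀ r : K, P (algebraMap K _ r)) (gen : ∀ g, P ((univ K).gen g))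
    (add : ∀ p q, P p → P q → P (p + q)) (mul : ∀ p q, P p → P q → P (p * q))
    (p : PreprojectiveD4 K) : P p := by
  obtain ⟨p, rfl⟩ := RingQuot.mkAlgHom_surjective K (PreprojectiveD4Rel K) p
  obtain ⟨p, rfl⟩ := RingQuot.mkAlgHom_surjective K (PathAlgebraRel K D4Vertex) p
  induction p using FreeAlgebra.induction with
  | grade0 r =>
    have h := algebraMap r
    rwa [← AlgHom.commutes ((proj K).comp (PathAlgebra.mk K D4Vertex))] at h
  | grade1 g =>
    cases g with
    | vertex x => exact gen (.vertex x)
    | arrow f => exact gen (.arrow f)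
  | mul p q hp hq =>
    have h := mul _ _ hp hq
    change P (proj K (PathAlgebra.mk K D4Vertex p) * proj K (PathAlgebra.mk K D4Vertex q)) at h
    rwa [← map_mul, ← map_mul] at h
  | add p q hp hq =>
    have h := add _ _ hp hq
    change P (proj K (PathAlgebra.mk K D4Vertex p) + proj K (PathAlgebra.mk K D4Vertex q)) at h
    rwa [← map_add, ← map_add] at h

theorem algHom_ext {B : Type v} [Ring B] [Algebra K B] {φ ψ : PreprojectiveD4 K →ₐ[K] B}
    (h : ∀ g, φ ((univ K).gen g) = ψ ((univ K).gen g)) : φ = ψ := by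
  ext p
  induction p using induction with
  | algebraMap r => rw [AlgHom.commutes, AlgHom.commutes]
  | gen g => exact h g
  | add p q hp hq => rw [map_add, map_add, hp, hq]
  | mul p q hp hq => rw [map_mul, map_mul, hp, hq]

end PreprojectiveD4

namespace PreprojectiveD4

/-! ### Sparse matrices with entries `0` and `1` in characteristic `2` -/

/-- The matrix whose `j`-th column is the sum of the unit vectors listed in `c j`. -/
def sparse (K : Type u) [Semiring K] {n : ℕ} (c : Fin n → List (Fin n)) :
    Matrix (Fin n) (Fin n) K :=
  Matrix.of fun i j => ((c j).count i : K)

/-- The sum of the unit vectors in a list. -/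
def sparseVec (K : Type u) [Semiring K] {n : ℕ} (l : List (Fin n)) : Fin n → K :=
  fun i => (l.count i : K)

/-- The columns of a sparse matrix with given positions of the nonzero entries. -/
def columns {n : ℕ} (l : List (Fin n × Fin n)) (j : Fin n) : List (Fin n) :=
  (l.filter fun p => p.2 = j).map Prod.fst

section sparse

variable {K : Type u} [Semiring K] {n : ℕ}

theorem sparse_mulVec (c : Fin n → List (Fin n)) (l : List (Fin n)) :
    (sparse K c).mulVec (sparseVec K l) = sparseVec K (l.flatMap c) := by
  ext i
  induction l with
  | nil => simp [Matrix.mulVec, dotProduct, sparseVec]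
  | cons k l ih =>
    simp only [Matrix.mulVec, dotProduct, sparseVec, sparse, Matrix.of_apply, List.flatMap_cons,
      List.count_append, List.count_cons, Nat.cast_add, mul_add, Finset.sum_add_distrib] at ih ⊢
    rw [ih, add_comm]
    congr 1
    rw [Finset.sum_eq_single k (fun b _ h => by simp [h.symm]) (by simp)]
    simp

theorem sparse_mul (c d : Fin n → List (Fin n)) :
    sparse K c * sparse K d = sparse K fun j => (d j).flatMap c := by
  ext i j
  exact congrFun (sparse_mulVec c (d j)) i

theorem sparse_add (c d : Fin n → List (Fin n)) :
    sparse K c + sparse K d = sparse K fun j => c j ++ d j := by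
  ext i j
  simp [sparse]

end sparse

theorem natCast_eq_natCast_of_mod_two {K : Type u} [Ring K] [CharP K 2] {a b : ℕ}
    (h : a % 2 = b % 2) : (a : K) = b :=
  (CharP.cast_eq_iff_mod_eq K 2).mpr h

/-- Reduces a matrix identity over K to parities of multiplicities in lists, which the kernel can
evaluate without arithmetic in K. -/
theorem sparse_congr {K : Type u} [Ring K] [CharP K 2] {n : ℕ} {c d : Fin n → List (Fin n)}
    (h : ∀ j i, (c j).count i % 2 = (d j).count i % 2) : sparse K c = sparse K d := by
  ext i j
  exact natCast_eq_natCast_of_mod_two (h j i)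

theorem sparse_eq_zero {K : Type u} [Ring K] [CharP K 2] {n : ℕ} {c : Fin n → List (Fin n)}
    (h : ∀ j i, (c j).count i % 2 = 0) : sparse K c = 0 := by
  ext i j
  exact (natCast_eq_natCast_of_mod_two (K := K) (b := 0) (h j i)).trans Nat.cast_zero

/-! ### The basis of paths and the left regular representation -/

/-- The paths forming a basis of the preprojective algebra of type `D₄`. -/
def basisPath : Fin 28 → List Gen :=
  ![[.vertex .v1],
    [.arrow D4Arrow.α],
    [.arrow D4Arrow.α, .arrow D4Arrow.δ],
    [.arrow D4Arrow.α, .arrow D4Arrow.ε],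
    [.arrow D4Arrow.α, .arrow D4Arrow.δ, .arrow D4Arrow.γ],
    [.arrow D4Arrow.α, .arrow D4Arrow.δ, .arrow D4Arrow.γ, .arrow D4Arrow.β],
    [.vertex .v2],
    [.arrow D4Arrow.ξ],
    [.arrow D4Arrow.ξ, .arrow D4Arrow.β],
    [.arrow D4Arrow.ξ, .arrow D4Arrow.δ],
    [.arrow D4Arrow.ξ, .arrow D4Arrow.β, .arrow D4Arrow.α],
    [.arrow D4Arrow.ξ, .arrow D4Arrow.β, .arrow D4Arrow.α, .arrow D4Arrow.ε],
    [.vertex .v3],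
    [.arrow D4Arrow.γ],
    [.arrow D4Arrow.γ, .arrow D4Arrow.β],
    [.arrow D4Arrow.γ, .arrow D4Arrow.ε],
    [.arrow D4Arrow.γ, .arrow D4Arrow.β, .arrow D4Arrow.α],
    [.arrow D4Arrow.γ, .arrow D4Arrow.β, .arrow D4Arrow.α, .arrow D4Arrow.δ],
    [.vertex .v4],
    [.arrow D4Arrow.β],
    [.arrow D4Arrow.δ],
    [.arrow D4Arrow.ε],
    [.arrow D4Arrow.β, .arrow D4Arrow.α],
    [.arrow D4Arrow.δ, .arrow D4Arrow.γ],
    [.arrow D4Arrow.δ, .arrow D4Arrow.γ, .arrow D4Arrow.β],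
    [.arrow D4Arrow.β, .arrow D4Arrow.α, .arrow D4Arrow.δ],
    [.arrow D4Arrow.β, .arrow D4Arrow.α, .arrow D4Arrow.ε],
    [.arrow D4Arrow.β, .arrow D4Arrow.α, .arrow D4Arrow.δ, .arrow D4Arrow.γ]]

/-- The starting vertex of a basis path. -/
def source : Fin 28 → D4Vertex :=
  ![.v1, .v1, .v1, .v1, .v1, .v1, .v2, .v2, .v2, .v2, .v2, .v2, .v3, .v3, .v3, .v3, .v3, .v3,
    .v4, .v4, .v4, .v4, .v4, .v4, .v4, .v4, .v4, .v4]

/-- The end vertex of a basis path. -/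
def target : Fin 28 → D4Vertex :=
  ![.v1, .v4, .v3, .v2, .v4, .v1, .v2, .v4, .v1, .v3, .v4, .v2, .v3, .v4, .v1, .v2, .v4, .v3,
    .v4, .v1, .v3, .v2, .v4, .v4, .v1, .v3, .v2, .v4]

/-- Left multiplication by a trivial path on the basis. -/
def vertexColumns (x : D4Vertex) (j : Fin 28) : List (Fin 28) :=
  if x = source j then [j] else []

/-- Left multiplication by an arrow on the basis. -/
def arrowColumns : ∀ {x y : D4Vertex}, D4Arrow x y → Fin 28 → List (Fin 28)
  | _, _, .α => columns [(1, 18), (2, 20), (3, 21), (4, 23), (5, 24)]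
  | _, _, .β => columns [(19, 0), (22, 1), (25, 2), (26, 3), (27, 4)]
  | _, _, .γ => columns [(13, 18), (14, 19), (15, 21), (16, 22), (17, 25)]
  | _, _, .δ => columns [(20, 12), (23, 13), (24, 14), (26, 15), (27, 16)]
  | _, _, .ε => columns [(21, 6), (22, 7), (23, 7), (24, 8), (25, 9), (27, 10)]
  | _, _, .ξ => columns [(7, 18), (8, 19), (9, 20), (10, 22), (10, 23), (11, 26)]

/-- Left multiplication by a generator on the basis. -/
def genColumns : Gen → Fin 28 → List (Fin 28)
  | .vertex x => vertexColumns x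
  | .arrow f => arrowColumns f

/-- The left regular representation on generators. -/
def regular (K : Type u) [Field K] [CharP K 2] : Rep (Matrix (Fin 28) (Fin 28) K) where
  e x := sparse K (vertexColumns x)
  a f := sparse K (arrowColumns f)
  idem x := by
    rw [sparse_mul]; refine sparse_congr ?_; revert x; decide +kernel
  orth x y := by
    rw [sparse_mul]; intro h; refine sparse_eq_zero ?_; revert x y; decide +kernel
  sum_eq_one := by
    ext i j
    simp only [Matrix.sum_apply, sparse, vertexColumns, Matrix.of_apply, Matrix.one_apply,
      apply_ite (List.count i), List.count_singleton, List.count_nil]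
    simp [eq_comm (a := i)]
  origin f := by
    rw [sparse_mul]; refine sparse_congr ?_; cases f <;> decide +kernel
  terminus f := by
    rw [sparse_mul]; refine sparse_congr ?_; cases f <;> decide +kernel
  rel1 := by rw [sparse_mul]; refine sparse_eq_zero ?_; decide +kernel
  rel2 := by rw [sparse_mul]; refine sparse_eq_zero ?_; decide +kernel
  rel3 := by rw [sparse_mul]; refine sparse_eq_zero ?_; decide +kernel
  rel4 := by simp only [sparse_mul, sparse_add]; refine sparse_eq_zero ?_; decide +kernel

/-! ### Straightening rules for products of paths -/

namespace Rep

variable {B : Type v} [Ring B] (R : Rep B)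

/-- The product of a list of generators. -/
def path (l : List Gen) : B := (l.map R.gen).prod

section rules

theorem mul_mul_eq_zero {p q : B} (h : p * q = 0) (t : B) : p * (q * t) = 0 := by
  rw [← mul_assoc, h, zero_mul]

theorem rel1' (t : B) : R.a .α * (R.a .β * t) = 0 := mul_mul_eq_zero R.rel1 t
theorem rel3' (t : B) : R.a .γ * (R.a .δ * t) = 0 := mul_mul_eq_zero R.rel3 t

theorem e_mul_path (x : D4Vertex) (j : Fin 28) :
    R.e x * R.path (basisPath j) = if x = source j then R.path (basisPath j) else 0 := by
  fin_cases j <;>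
    simp [path, basisPath, gen, source, e_mul_e, e_mul_a, e_mul_a_mul] <;>
    split_ifs with h <;> simp [h]

theorem path_mul_e (j : Fin 28) (y : D4Vertex) :
    R.path (basisPath j) * R.e y = if y = target j then R.path (basisPath j) else 0 := by
  fin_cases j <;>
    simp [path, basisPath, gen, target, e_mul_e, a_mul_e, mul_assoc, eq_comm (b := y)]

variable [CharP B 2]

theorem ε_mul_ξ : R.a .ε * R.a .ξ = R.a .β * R.a .α + R.a .δ * R.a .γ :=
  (CharTwo.add_eq_zero.mp R.rel4).symm

theorem ε_mul_ξ_mul (t : B) :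
    R.a .ε * (R.a .ξ * t) = R.a .β * (R.a .α * t) + R.a .δ * (R.a .γ * t) := by
  rw [← mul_assoc, ε_mul_ξ, add_mul, mul_assoc, mul_assoc]

/-- The branch relation multiplied on the right by ε, where ξε = 0. -/
theorem δγε : R.a .δ * (R.a .γ * R.a .ε) = R.a .β * (R.a .α * R.a .ε) := by
  have h := R.ε_mul_ξ_mul (R.a .ε)
  rw [rel2, mul_zero] at h
  exact (CharTwo.add_eq_zero.mp h.symm).symm

theorem ξδγ : R.a .ξ * (R.a .δ * R.a .γ) = R.a .ξ * (R.a .β * R.a .α) := by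
  have h := congrArg (R.a .ξ * ·) R.ε_mul_ξ
  simp only [← mul_assoc, rel2, zero_mul, mul_add] at h
  simpa only [mul_assoc] using (CharTwo.add_eq_zero.mp h.symm).symm

theorem ξδγ_mul (t : B) :
    R.a .ξ * (R.a .δ * (R.a .γ * t)) = R.a .ξ * (R.a .β * (R.a .α * t)) := by
  have h := congrArg (· * t) R.ξδγ
  simpa only [mul_assoc] using h

/-- Multiply ξδγ = ξβα by ε on the left and expand εξ: αβ = 0 and γδ = 0 leave one term on each
side. -/
theorem δγβα :
    R.a .δ * (R.a .γ * (R.a .β * R.a .α)) = R.a .β * (R.a .α * (R.a .δ * R.a .γ)) := by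
  have h := congrArg (R.a .ε * ·) R.ξδγ
  simp only [ε_mul_ξ_mul, rel1', rel3', mul_zero, add_zero, zero_add] at h
  exact h.symm

theorem δγβα_mul (t : B) : R.a .δ * (R.a .γ * (R.a .β * (R.a .α * t))) =
    R.a .β * (R.a .α * (R.a .δ * (R.a .γ * t))) := by
  have h := congrArg (· * t) R.δγβα
  simpa only [mul_assoc] using h

theorem ξβαδ : R.a .ξ * (R.a .β * (R.a .α * R.a .δ)) = 0 := by
  rw [← ξδγ_mul, rel3, mul_zero, mul_zero]

theorem ξβαδ_mul (t : B) : R.a .ξ * (R.a .β * (R.a .α * (R.a .δ * t))) = 0 := by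
  rw [← ξδγ_mul, rel3', mul_zero, mul_zero]

theorem γβαδγ : R.a .γ * (R.a .β * (R.a .α * (R.a .δ * R.a .γ))) = 0 := by
  rw [← δγβα, rel3']

theorem βαδγβ : R.a .β * (R.a .α * (R.a .δ * (R.a .γ * R.a .β))) = 0 := by
  rw [← δγβα_mul, rel1, mul_zero, mul_zero, mul_zero]

theorem γβαε : R.a .γ * (R.a .β * (R.a .α * R.a .ε)) = 0 := by
  rw [← δγε, rel3']

/-- The straightening rules are complete enough to bring each product of an arrow with a basis path
to the form tabulated in `arrowColumns`. Hence the span of these paths is a left ideal. -/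
theorem a_mul_path {x y : D4Vertex} (f : D4Arrow x y) (j : Fin 28) :
    R.a f * R.path (basisPath j) =
      ((arrowColumns f j).map fun i => R.path (basisPath i)).sum := by
  cases f <;> fin_cases j <;>
    simp [path, basisPath, gen, arrowColumns, columns, a_mul_e, a_mul_a_eq_zero,
      a_mul_a_mul_eq_zero, rel1, rel2, rel3, rel1', rel3', ε_mul_ξ, ε_mul_ξ_mul, δγε, ξδγ,
      ξδγ_mul, δγβα, δγβα_mul, ξβαδ, ξβαδ_mul, γβαδγ, βαδγβ, γβαε]

theorem gen_mul_path (g : Gen) (j : Fin 28) :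
    R.gen g * R.path (basisPath j) =
      ((genColumns g j).map fun i => R.path (basisPath i)).sum := by
  rcases g with x | f
  · simp only [gen, e_mul_path, genColumns, vertexColumns]
    split_ifs <;> simp
  · exact R.a_mul_path f j

end rules

end Rep

end PreprojectiveD4

/-! ### Coordinates, trace form and corners -/

namespace PreprojectiveD4

theorem list_sum_map_eq (K : Type u) {M : Type v} [Semiring K] [AddCommMonoid M] [Module K M]
    {n : ℕ} (l : List (Fin n)) (φ : Fin n → M) :
    (l.map φ).sum = ∑ i, (l.count i : K) • φ i := by
  induction l with
  | nil => simp
  | cons k l ih =>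
    simp only [List.map_cons, List.sum_cons, ih, List.count_cons, Nat.cast_add, add_smul,
      Finset.sum_add_distrib]
    rw [add_comm]
    congr 1
    rw [Finset.sum_eq_single k (fun b _ h => by simp [h.symm]) (by simp)]
    simp

variable {K : Type u} [Field K]

/-- The linear combination of the basis paths with given coefficients. -/
noncomputable def comb : (Fin 28 → K) →ₗ[K] PreprojectiveD4 K :=
  Fintype.linearCombination K fun i => (univ K).path (basisPath i)

theorem comb_apply (v : Fin 28 → K) :
    comb v = ∑ i, v i • (univ K).path (basisPath i) :=
  Fintype.linearCombination_apply ..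

/-- The list of trivial paths. -/
abbrev trivialPaths : List (Fin 28) := [0, 6, 12, 18]

theorem comb_trivialPaths : comb (sparseVec K trivialPaths) = (1 : PreprojectiveD4 K) := by
  rw [comb_apply]
  simp only [sparseVec]
  rw [← list_sum_map_eq K, ← (univ K).sum_eq_one]
  simp only [Finset.sum, Finset.univ, Fintype.elems]
  simp [Rep.path, basisPath, Rep.gen]

/-! ### Characters -/

/-- The character of a simple module. -/
noncomputable def character (x : D4Vertex) : PreprojectiveD4 K →ₐ[K] K :=
  Rep.lift (B := K)
    { e := fun y => if y = x then 1 else 0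
      a := fun _ => 0
      idem := fun y => by split_ifs <;> simp
      orth := fun y z h => by
        by_cases hy : y = x
        · rw [if_neg fun hz => h (hy.trans (Eq.symm hz)), mul_zero]
        · rw [if_neg hy, zero_mul]
      sum_eq_one := by simp
      origin := fun _ => mul_zero _
      terminus := fun _ => zero_mul _
      rel1 := mul_zero _
      rel2 := mul_zero _
      rel3 := mul_zero _
      rel4 := by simp }

@[simp]
theorem character_e (x y : D4Vertex) :
    character x ((univ K).e y) = if y = x then 1 else 0 :=
  Rep.lift_e _ y

@[simp]
theorem character_a (x : D4Vertex) {y z : D4Vertex} (f : D4Arrow y z) :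
    character x ((univ K).a f) = 0 :=
  Rep.lift_a _ f

/-! ### The basis of paths -/

variable [CharP K 2]

instance : Nontrivial (PreprojectiveD4 K) :=
  (regular K).lift.toRingHom.domain_nontrivial

instance : CharP (PreprojectiveD4 K) 2 :=
  charP_of_injective_algebraMap (algebraMap K _).injective 2

/-- The coordinates of an element with respect to the basis of paths. -/
noncomputable def coord : PreprojectiveD4 K →ₗ[K] (Fin 28 → K) :=
  (LinearMap.applyₗ (sparseVec K trivialPaths)).comp
    (Matrix.mulVecBilin K K |>.comp (regular K).lift.toLinearMap)

theorem coord_apply (p : PreprojectiveD4 K) :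
    coord p = ((regular K).lift p).mulVec (sparseVec K trivialPaths) := rfl

theorem regular_gen (g : Gen) : (regular K).gen g = sparse K (genColumns g) := by
  cases g <;> rfl

/-- `comb` intertwines the matrix representation with left multiplication; by `induction` it
suffices to check generators, where this is `gen_mul_path`. -/
theorem mul_comb (p : PreprojectiveD4 K) (v : Fin 28 → K) :
    p * comb v = comb (((regular K).lift p).mulVec v) := by
  induction p using induction generalizing v with
  | algebraMap r =>
    rw [AlgHom.commutes, Matrix.algebraMap_eq_diagonal, ← Algebra.smul_def, ← map_smul]
    congr 1
    ext i
    simp [Matrix.mulVec_diagonal]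
  | add p q hp hq => rw [add_mul, hp, hq, map_add, Matrix.add_mulVec, map_add]
  | mul p q hp hq => rw [mul_assoc, hq, hp, map_mul, Matrix.mulVec_mulVec]
  | gen g =>
    rw [Rep.lift_gen, regular_gen]
    simp only [comb_apply, Finset.mul_sum, mul_smul_comm, Rep.gen_mul_path, list_sum_map_eq K,
      Matrix.mulVec, dotProduct, Finset.sum_smul, Finset.smul_sum, smul_smul]
    rw [Finset.sum_comm]
    simp [sparse, mul_comm]

/-- The matrix of p is applied to the coordinates of 1. The paths therefore span, and `coord` is
injective without a separate proof of linear independence. -/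
theorem comb_coord (p : PreprojectiveD4 K) : comb (coord p) = p := by
  rw [coord_apply, ← mul_comb, comb_trivialPaths, mul_one]

theorem coord_injective : Function.Injective (coord (K := K)) :=
  Function.LeftInverse.injective comb_coord

/-- The left regular representation is faithful. -/
theorem regular_lift_injective : Function.Injective ((regular K).lift : PreprojectiveD4 K →ₐ[K] _) := by
  intro p q h
  apply coord_injective
  rw [coord_apply, coord_apply, h]

/-- The action of a path on sums of basis elements. -/
def act (l : List Gen) (s : List (Fin 28)) : List (Fin 28) :=
  l.foldr (fun g s => s.flatMap (genColumns g)) s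

theorem coord_path (l : List Gen) :
    coord ((univ K).path l) = sparseVec K (act l trivialPaths) := by
  rw [coord_apply]
  induction l with
  | nil => simp [Rep.path, act]
  | cons g l ih =>
    rw [Rep.path, List.map_cons, List.prod_cons, map_mul, ← Matrix.mulVec_mulVec]
    rw [Rep.path] at ih
    rw [ih, Rep.lift_gen, regular_gen, sparse_mulVec]
    rfl

/-! ### The symmetrizing form -/

/-- The symmetrizing form: the sum of the coefficients of the paths of length `4`. -/
noncomputable def tr : PreprojectiveD4 K →ₗ[K] K :=
  let p := LinearMap.proj (R := K) (φ := fun _ : Fin 28 => K)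
  (p 5 + p 11 + p 17 + p 27).comp coord

/-- The sum of the coefficients of the paths of length `4`. -/
def trCount (l : List (Fin 28)) : ℕ := l.count 5 + l.count 11 + l.count 17 + l.count 27

theorem tr_path (l : List Gen) :
    tr ((univ K).path l) = (trCount (act l trivialPaths) : K) := by
  simp [tr, coord_path, sparseVec, trCount]

/-- By linearity p may be taken to be a basis path; both traces are then parities computed from
lists. -/
theorem tr_a_mul {x y : D4Vertex} (f : D4Arrow x y) (p : PreprojectiveD4 K) :
    tr ((univ K).a f * p) = tr (p * (univ K).a f) := by
  rw [← comb_coord p, comb_apply, Finset.mul_sum, Finset.sum_mul, map_sum, map_sum]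
  refine Finset.sum_congr rfl ?_
  intro i hi
  clear hi
  rw [mul_smul_comm, smul_mul_assoc, map_smul, map_smul]
  congr 1
  have h₁ : (univ K).a f * (univ K).path (basisPath i) =
      (univ K).path (.arrow (x := x) (y := y) f :: basisPath i) := by
    simp [Rep.path, Rep.gen]
  have h₂ : (univ K).path (basisPath i) * (univ K).a f =
      (univ K).path (basisPath i ++ [.arrow (x := x) (y := y) f]) := by
    simp [Rep.path, Rep.gen]
  rw [h₁, h₂, tr_path, tr_path]
  apply natCast_eq_natCast_of_mod_two
  clear h₁ h₂
  revert i
  cases f <;> decide +kernel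

/-! ### Corners -/

theorem corner_eq (x y : D4Vertex) (r : PreprojectiveD4 K) (h : (univ K).e x * r = r)
    (h' : r * (univ K).e y = r) :
    r = ∑ i, if x = source i ∧ y = target i then
      coord r i • (univ K).path (basisPath i) else 0 := by
  conv_lhs => rw [← h', ← h, ← comb_coord r, comb_apply, Finset.mul_sum, Finset.sum_mul]
  refine Finset.sum_congr rfl fun i _ => ?_
  rw [mul_smul_comm, smul_mul_assoc, Rep.e_mul_path, ite_mul, zero_mul, Rep.path_mul_e]
  split_ifs <;> simp_all

theorem corner_v1 (r : PreprojectiveD4 K) (h : (univ K).e .v1 * r = r)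
    (h' : r * (univ K).e .v1 = r) : ∃ l s : K, r = l • (univ K).e .v1 +
      s • ((univ K).a .α * ((univ K).a .δ * ((univ K).a .γ * (univ K).a .β))) := by
  refine ⟨coord r 0, coord r 5, ?_⟩
  conv_lhs => rw [corner_eq .v1 .v1 r h h']
  simp [Fin.sum_univ_succ, source, target, Rep.path, basisPath, Rep.gen]

theorem corner_v2 (r : PreprojectiveD4 K) (h : (univ K).e .v2 * r = r)
    (h' : r * (univ K).e .v2 = r) : ∃ l s : K, r = l • (univ K).e .v2 +
      s • ((univ K).a .ξ * ((univ K).a .β * ((univ K).a .α * (univ K).a .ε))) := by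
  refine ⟨coord r 6, coord r 11, ?_⟩
  conv_lhs => rw [corner_eq .v2 .v2 r h h']
  simp [Fin.sum_univ_succ, source, target, Rep.path, basisPath, Rep.gen]

theorem corner_v3 (r : PreprojectiveD4 K) (h : (univ K).e .v3 * r = r)
    (h' : r * (univ K).e .v3 = r) : ∃ l s : K, r = l • (univ K).e .v3 +
      s • ((univ K).a .γ * ((univ K).a .β * ((univ K).a .α * (univ K).a .δ))) := by
  refine ⟨coord r 12, coord r 17, ?_⟩
  conv_lhs => rw [corner_eq .v3 .v3 r h h']
  simp [Fin.sum_univ_succ, source, target, Rep.path, basisPath, Rep.gen]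

theorem corner_v4 (r : PreprojectiveD4 K) (h : (univ K).e .v4 * r = r)
    (h' : r * (univ K).e .v4 = r) : ∃ l p q s : K, r = l • (univ K).e .v4 +
      p • ((univ K).a .β * (univ K).a .α) + q • ((univ K).a .δ * (univ K).a .γ) +
      s • ((univ K).a .β * ((univ K).a .α * ((univ K).a .δ * (univ K).a .γ))) := by
  refine ⟨coord r 18, coord r 22, coord r 23, coord r 27, ?_⟩
  conv_lhs => rw [corner_eq .v4 .v4 r h h']
  simp [Fin.sum_univ_succ, source, target, Rep.path, basisPath, Rep.gen, add_assoc]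

end PreprojectiveD4

/-! ### Cocycles from derivations into a cokernel -/

section Cokernel

open MulOpposite (op)

variable {K : Type u} [Field K] {A : Type v} [Ring A] [Algebra K A] {B : Type w} [Ring B]
  [Algebra K B] (ρ : A →ₐ[K] B)

/-- The cokernel of an algebra homomorphism `A → B`, an `A`-bimodule. -/
def BimoduleCokernel : Type w := B ⧸ LinearMap.range ρ.toLinearMap

namespace BimoduleCokernel

noncomputable instance : AddCommGroup (BimoduleCokernel ρ) :=
  inferInstanceAs (AddCommGroup (B ⧸ LinearMap.range ρ.toLinearMap))

noncomputable instance : Module K (BimoduleCokernel ρ) :=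
  inferInstanceAs (Module K (B ⧸ LinearMap.range ρ.toLinearMap))

/-- The canonical projection. -/
noncomputable def mk : B →ₗ[K] BimoduleCokernel ρ := (LinearMap.range ρ.toLinearMap).mkQ

theorem mk_surjective : Function.Surjective (mk ρ) := Submodule.mkQ_surjective _

theorem mk_eq_zero {b : B} : mk ρ b = 0 ↔ ∃ a, ρ a = b :=
  (Submodule.Quotient.mk_eq_zero _).trans Iff.rfl

/-- The endomorphism of the cokernel induced by an endomorphism that preserves the image. -/
noncomputable def induced (φ : B →ₗ[K] B) (h : ∀ a, ∃ a', ρ a' = φ (ρ a)) :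
    Module.End K (BimoduleCokernel ρ) :=
  Submodule.mapQ _ _ φ (by rintro _ ⟨a, rfl⟩; exact h a)

theorem induced_mk (φ : B →ₗ[K] B) (h : ∀ a, ∃ a', ρ a' = φ (ρ a)) (b : B) :
    induced ρ φ h (mk ρ b) = mk ρ (φ b) := rfl

theorem end_ext {φ ψ : Module.End K (BimoduleCokernel ρ)} (h : ∀ b, φ (mk ρ b) = ψ (mk ρ b)) :
    φ = ψ := by
  ext n
  obtain ⟨b, rfl⟩ := mk_surjective ρ n
  exact h b

/-- The left action of `A` on the cokernel. -/
noncomputable def leftAction : A →+* Module.End K (BimoduleCokernel ρ) where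
  toFun a := induced ρ (LinearMap.mulLeft K (ρ a)) fun a' => ⟨a * a', by simp⟩
  map_one' := end_ext ρ fun b => by simp [induced_mk]
  map_zero' := end_ext ρ fun b => by simp [induced_mk]
  map_mul' a a' := end_ext ρ fun b => by simp [induced_mk]
  map_add' a a' := end_ext ρ fun b => by simp [induced_mk, add_mul]

/-- The right action of `A` on the cokernel. -/
noncomputable def rightAction : Aᵐᵒᵖ →+* Module.End K (BimoduleCokernel ρ) where
  toFun a := induced ρ (LinearMap.mulRight K (ρ a.unop)) fun a' => ⟨a' * a.unop, by simp⟩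
  map_one' := end_ext ρ fun b => by simp [induced_mk]
  map_zero' := end_ext ρ fun b => by simp [induced_mk]
  map_mul' a a' := end_ext ρ fun b => by simp [induced_mk, mul_assoc]
  map_add' a a' := end_ext ρ fun b => by simp [induced_mk, mul_add]

noncomputable instance : Module A (BimoduleCokernel ρ) := Module.compHom _ (leftAction ρ)

noncomputable instance : Module Aᵐᵒᵖ (BimoduleCokernel ρ) := Module.compHom _ (rightAction ρ)

theorem smul_mk (a : A) (b : B) : a • mk ρ b = mk ρ (ρ a * b) := rfl

theorem op_smul_mk (a : A) (b : B) : op a • mk ρ b = mk ρ (b * ρ a) := rfl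

instance : SMulCommClass A Aᵐᵒᵖ (BimoduleCokernel ρ) where
  smul_comm a a' n := by
    obtain ⟨b, rfl⟩ := mk_surjective ρ n
    obtain ⟨a', rfl⟩ := MulOpposite.op_surjective a'
    rw [op_smul_mk, smul_mk, smul_mk, op_smul_mk, mul_assoc]

instance : IsScalarTower K A (BimoduleCokernel ρ) where
  smul_assoc r a n := by
    obtain ⟨b, rfl⟩ := mk_surjective ρ n
    rw [smul_mk, smul_mk, map_smul, smul_mul_assoc, map_smul]

instance : IsScalarTower K Aᵐᵒᵖ (BimoduleCokernel ρ) where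
  smul_assoc r a n := by
    obtain ⟨b, rfl⟩ := mk_surjective ρ n
    obtain ⟨a, rfl⟩ := MulOpposite.op_surjective a
    rw [← MulOpposite.op_smul, op_smul_mk, op_smul_mk, map_smul, mul_smul_comm, map_smul]

end BimoduleCokernel

open BimoduleCokernel

/-- A derivation into the cokernel of an injective algebra homomorphism lifts to a linear map
whose Hochschild differential is a cocycle with values in the algebra. -/
theorem exists_cocycle_of_derivation (hρ : Function.Injective ρ)
    (D : A →ₗ[K] BimoduleCokernel ρ)
    (hD : ∀ a b, D (a * b) = a • D b + op b • D a) :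
    ∃ (f : A ⊗[K] A →ₗ[K] A) (c : A →ₗ[K] B), f ∈ hochschildZ2 K A ∧ (∀ a, mk ρ (c a) = D a) ∧
      ∀ a b, ρ (f (a ⊗ₜ b)) = ρ a * c b - c (a * b) + c a * ρ b := by
  -- Over a field the projection B → B/A has a linear section s and ρ has a linear retraction σ. The
  -- derivation lifts to c = s ∘ D, whose differential takes values in the image of ρ because D is a
  -- derivation.
  obtain ⟨s, hs⟩ := (mk ρ).exists_rightInverse_of_surjective
    (LinearMap.range_eq_top.mpr (mk_surjective ρ))
  obtain ⟨σ, hσ⟩ := ρ.toLinearMap.exists_leftInverse_of_injective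
    (LinearMap.ker_eq_bot.mpr hρ)
  replace hs : ∀ n, mk ρ (s n) = n := LinearMap.congr_fun hs
  replace hσ : ∀ a, σ (ρ a) = a := LinearMap.congr_fun hσ
  let c := s ∘ₗ D
  let f : A ⊗[K] A →ₗ[K] A := σ ∘ₗ (LinearMap.mul' K B ∘ₗ TensorProduct.map ρ.toLinearMap c -
    c ∘ₗ LinearMap.mul' K A + LinearMap.mul' K B ∘ₗ TensorProduct.map c ρ.toLinearMap)
  have hf : ∀ a b, ρ (f (a ⊗ₜ b)) = ρ a * c b - c (a * b) + c a * ρ b := by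
    intro a b
    obtain ⟨x, hx⟩ : ∃ x, ρ x = ρ a * c b - c (a * b) + c a * ρ b := by
      rw [← mk_eq_zero, map_add, map_sub, ← smul_mk, ← op_smul_mk]
      simp only [c, LinearMap.comp_apply, hs, hD]
      abel
    have : f (a ⊗ₜ b) = σ (ρ a * c b - c (a * b) + c a * ρ b) := by simp [f]
    rw [this, ← hx, hσ]
  refine ⟨f, c, fun a b d => hρ ?_, fun a => hs _, hf⟩
  -- After applying ρ, the cocycle condition is d² = 0 for the cochain c.
  simp only [map_add, map_sub, map_mul, hf, map_zero, mul_assoc]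
  noncomm_ring

end Cokernel

/-! ### Cocycles from deformed arrows -/

namespace PreprojectiveD4

section Cocycle

open BimoduleCokernel
open MulOpposite (op)

variable {K : Type u} [Field K]

/-- Infinitesimal deformations of the arrows in an overring `B`, such that the defects of the
relations lie in the algebra, give rise to a Hochschild cocycle with these defects. -/
theorem exists_cocycle {B : Type w} [Ring B] [Algebra K B] (ρ : PreprojectiveD4 K →ₐ[K] B)
    (hρ : Function.Injective ρ) (C : ∀ {x y : D4Vertex}, D4Arrow x y → B)
    (origin : ∀ {x y : D4Vertex} (a : D4Arrow x y), ρ ((univ K).e x) * C a = C a)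
    (terminus : ∀ {x y : D4Vertex} (a : D4Arrow x y), C a * ρ ((univ K).e y) = C a)
    (r₁ r₂ r₃ r₄ : PreprojectiveD4 K)
    (h₁ : ρ ((univ K).a .α) * C .β + C .α * ρ ((univ K).a .β) = ρ r₁)
    (h₂ : ρ ((univ K).a .ξ) * C .ε + C .ξ * ρ ((univ K).a .ε) = ρ r₂)
    (h₃ : ρ ((univ K).a .γ) * C .δ + C .γ * ρ ((univ K).a .δ) = ρ r₃)
    (h₄ : ρ ((univ K).a .β) * C .α + C .β * ρ ((univ K).a .α) +
      (ρ ((univ K).a .δ) * C .γ + C .δ * ρ ((univ K).a .γ)) +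
      (ρ ((univ K).a .ε) * C .ξ + C .ε * ρ ((univ K).a .ξ)) = ρ r₄) :
    ∃ f ∈ hochschildZ2 K (PreprojectiveD4 K),
      ∃ u : ∀ x y : D4Vertex, D4Arrow x y → PreprojectiveD4 K,
      f ((univ K).a .α ⊗ₜ (univ K).a .β) =
        r₁ + ((univ K).a .α * u _ _ .β + u _ _ .α * (univ K).a .β) ∧
      f ((univ K).a .ξ ⊗ₜ (univ K).a .ε) =
        r₂ + ((univ K).a .ξ * u _ _ .ε + u _ _ .ξ * (univ K).a .ε) ∧
      f ((univ K).a .γ ⊗ₜ (univ K).a .δ) =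
        r₃ + ((univ K).a .γ * u _ _ .δ + u _ _ .γ * (univ K).a .δ) ∧
      f ((univ K).a .β ⊗ₜ (univ K).a .α) + f ((univ K).a .δ ⊗ₜ (univ K).a .γ) +
        f ((univ K).a .ε ⊗ₜ (univ K).a .ξ) =
        r₄ + (((univ K).a .β * u _ _ .α + u _ _ .β * (univ K).a .α) +
        ((univ K).a .δ * u _ _ .γ + u _ _ .δ * (univ K).a .γ) +
        ((univ K).a .ε * u _ _ .ξ + u _ _ .ε * (univ K).a .ξ)) := by
  have hzero : ∀ r, mk ρ (ρ r) = 0 := fun r => (mk_eq_zero ρ).mpr ⟨r, rfl⟩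
  -- In the trivial extension of A by B/A the arrows a + [C a] satisfy the relations, since the
  -- defects lie in A and so vanish in B/A. The second component of the resulting homomorphism is a
  -- derivation.
  let R : Rep (TrivSqZeroExt (PreprojectiveD4 K) (BimoduleCokernel ρ)) :=
    { e := fun x => .inl ((univ K).e x)
      a := fun a => .inl ((univ K).a a) + .inr (mk ρ (C a))
      idem := fun x => by rw [← TrivSqZeroExt.inl_mul, (univ K).idem]
      orth := fun x y h => by rw [← TrivSqZeroExt.inl_mul, (univ K).orth x y h]; rfl
      sum_eq_one := by
        rw [← TrivSqZeroExt.inl_one, ← (univ K).sum_eq_one]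
        exact (map_sum (TrivSqZeroExt.inlHom (PreprojectiveD4 K) (BimoduleCokernel ρ)) _ _).symm
      origin := fun a => by
        ext
        · simpa using (univ K).origin a
        · simp [smul_mk, origin]
      terminus := fun a => by
        ext
        · simpa using (univ K).terminus a
        · simp [op_smul_mk, terminus]
      rel1 := by
        ext
        · simpa using (univ K).rel1
        · simp [smul_mk, op_smul_mk, ← map_add, h₁, hzero]
      rel2 := by
        ext
        · simpa using (univ K).rel2
        · simp [smul_mk, op_smul_mk, ← map_add, h₂, hzero]
      rel3 := by
        ext
        · simpa using (univ K).rel3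
        · simp [smul_mk, op_smul_mk, ← map_add, h₃, hzero]
      rel4 := by
        ext
        · simpa using (univ K).rel4
        · simp [smul_mk, op_smul_mk, ← map_add, h₄, hzero] }
  have hfst : ∀ p, (R.lift p).fst = p := by
    have : (TrivSqZeroExt.fstHom K (PreprojectiveD4 K) (BimoduleCokernel ρ)).comp R.lift =
        AlgHom.id K _ := by
      refine algHom_ext fun g => ?_
      rw [AlgHom.comp_apply, Rep.lift_gen]
      cases g with
      | vertex x => rfl
      | arrow a => exact add_zero _
    exact DFunLike.congr_fun this
  let D : PreprojectiveD4 K →ₗ[K] BimoduleCokernel ρ :=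
    (TrivSqZeroExt.sndHom (PreprojectiveD4 K) (BimoduleCokernel ρ)).restrictScalars K ∘ₗ
      R.lift.toLinearMap
  have hDa : ∀ {x y : D4Vertex} (a : D4Arrow x y), D ((univ K).a a) = mk ρ (C a) := fun a => by
    change (R.lift ((univ K).a a)).snd = _
    rw [Rep.lift_a]
    exact zero_add _
  obtain ⟨f, c, hf, hc, hfc⟩ := exists_cocycle_of_derivation ρ hρ D fun p q => by
    change (R.lift (p * q)).snd = p • (R.lift q).snd + op q • (R.lift p).snd
    rw [map_mul, TrivSqZeroExt.snd_mul, hfst, hfst]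
  -- The lift c of the derivation and the chosen C agree on arrows modulo A; the difference u is
  -- what enters the defects of the cocycle.
  have hu : ∀ x y (a : D4Arrow x y), ∃ u, ρ u = c ((univ K).a a) - C a := fun x y a => by
    rw [← mk_eq_zero, map_sub, hc, hDa, sub_self]
  choose u hu using hu
  replace hu : ∀ {x y : D4Vertex} (a : D4Arrow x y), c ((univ K).a a) = C a + ρ (u x y a) :=
    fun a => by rw [hu]; abel
  refine ⟨f, hf, u, hρ ?_, hρ ?_, hρ ?_, hρ ?_⟩
  · simp only [hfc, hu, map_add, map_mul, ← h₁, (univ K).rel1, map_zero]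
    noncomm_ring
  · simp only [hfc, hu, map_add, map_mul, ← h₂, (univ K).rel2, map_zero]
    noncomm_ring
  · simp only [hfc, hu, map_add, map_mul, ← h₃, (univ K).rel3, map_zero]
    noncomm_ring
  -- The terms c(βα), c(δγ), c(εξ) cancel only in the sum, by the branch relation.
  · have h : c ((univ K).a .β * (univ K).a .α) + c ((univ K).a .δ * (univ K).a .γ) +
        c ((univ K).a .ε * (univ K).a .ξ) = 0 := by
      rw [← map_add, ← map_add, (univ K).rel4, map_zero]
    rw [← neg_eq_zero] at h
    rw [← sub_eq_zero, ← h]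
    simp only [hfc, hu, map_add, map_mul, ← h₄]
    noncomm_ring

end Cocycle

end PreprojectiveD4

/-! ### Invariants of cocycles -/

namespace PreprojectiveD4

variable {K : Type u} [Field K]

/-- The defect of the relation at the branch vertex. -/
noncomputable def branchDefect :
    (PreprojectiveD4 K ⊗[K] PreprojectiveD4 K →ₗ[K] PreprojectiveD4 K) →ₗ[K]
      PreprojectiveD4 K :=
  LinearMap.applyₗ ((univ K).a .β ⊗ₜ (univ K).a .α) +
    LinearMap.applyₗ ((univ K).a .δ ⊗ₜ (univ K).a .γ) +
    LinearMap.applyₗ ((univ K).a .ε ⊗ₜ (univ K).a .ξ)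

theorem branchDefect_apply
    (f : PreprojectiveD4 K ⊗[K] PreprojectiveD4 K →ₗ[K] PreprojectiveD4 K) :
    branchDefect f = f ((univ K).a .β ⊗ₜ (univ K).a .α) + f ((univ K).a .δ ⊗ₜ (univ K).a .γ) +
      f ((univ K).a .ε ⊗ₜ (univ K).a .ξ) := rfl

variable [CharP K 2]

/-- The invariants of a Hochschild cochain that determine the class of a cocycle. -/
noncomputable def invariants :
    (PreprojectiveD4 K ⊗[K] PreprojectiveD4 K →ₗ[K] PreprojectiveD4 K) →ₗ[K] K × K × K :=
  ((character .v1).toLinearMap ∘ₗ LinearMap.applyₗ ((univ K).a .α ⊗ₜ (univ K).a .β)).prod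
    (((character .v4).toLinearMap ∘ₗ branchDefect).prod
      (tr ∘ₗ (LinearMap.applyₗ ((univ K).a .α ⊗ₜ (univ K).a .β) +
        LinearMap.applyₗ ((univ K).a .ξ ⊗ₜ (univ K).a .ε) +
        LinearMap.applyₗ ((univ K).a .γ ⊗ₜ (univ K).a .δ) + branchDefect)))

theorem invariants_apply
    (f : PreprojectiveD4 K ⊗[K] PreprojectiveD4 K →ₗ[K] PreprojectiveD4 K) :
    invariants f = (character .v1 (f ((univ K).a .α ⊗ₜ (univ K).a .β)),
      character .v4 (branchDefect f),
      tr (f ((univ K).a .α ⊗ₜ (univ K).a .β) + f ((univ K).a .ξ ⊗ₜ (univ K).a .ε) +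
        f ((univ K).a .γ ⊗ₜ (univ K).a .δ) + branchDefect f)) := rfl

/-- Changing the lifts of the arrows does not change the symmetrizing form of the sum of the
defects. -/
theorem tr_commutators (u : ∀ x y : D4Vertex, D4Arrow x y → PreprojectiveD4 K) :
    tr (((univ K).a .α * u _ _ .β + u _ _ .α * (univ K).a .β) +
      ((univ K).a .ξ * u _ _ .ε + u _ _ .ξ * (univ K).a .ε) +
      ((univ K).a .γ * u _ _ .δ + u _ _ .γ * (univ K).a .δ) +
      (((univ K).a .β * u _ _ .α + u _ _ .β * (univ K).a .α) +
        ((univ K).a .δ * u _ _ .γ + u _ _ .δ * (univ K).a .γ) +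
        ((univ K).a .ε * u _ _ .ξ + u _ _ .ε * (univ K).a .ξ))) = 0 := by
  simp only [map_add, tr_a_mul]
  generalize tr (u _ _ D4Arrow.β * (univ K).a D4Arrow.α) = a₁
  generalize tr (u _ _ D4Arrow.α * (univ K).a D4Arrow.β) = a₂
  generalize tr (u _ _ D4Arrow.ε * (univ K).a D4Arrow.ξ) = a₃
  generalize tr (u _ _ D4Arrow.ξ * (univ K).a D4Arrow.ε) = a₄
  generalize tr (u _ _ D4Arrow.δ * (univ K).a D4Arrow.γ) = a₅
  generalize tr (u _ _ D4Arrow.γ * (univ K).a D4Arrow.δ) = a₆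
  -- Each arrow product contributes once to a leaf relation and once to the branch relation; the two
  -- traces agree and cancel in characteristic 2.
  linear_combination (a₁ + a₂ + a₃ + a₄ + a₅ + a₆) * CharTwo.two_eq_zero (R := K)

/-- The defects of a coboundary are those of a change of lifts by the values of g on arrows: the
remaining terms are g of a relation, hence zero. -/
theorem invariants_hochschildD1 (g : PreprojectiveD4 K →ₗ[K] PreprojectiveD4 K) :
    invariants (hochschildD1 K _ g) = 0 := by
  have h : g ((univ K).a .β * (univ K).a .α) + g ((univ K).a .δ * (univ K).a .γ) +
      g ((univ K).a .ε * (univ K).a .ξ) = 0 := by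
    rw [← map_add, ← map_add, (univ K).rel4, map_zero]
  have h' : branchDefect (hochschildD1 K _ g) =
      ((univ K).a .β * g ((univ K).a .α) + g ((univ K).a .β) * (univ K).a .α) +
      ((univ K).a .δ * g ((univ K).a .γ) + g ((univ K).a .δ) * (univ K).a .γ) +
      ((univ K).a .ε * g ((univ K).a .ξ) + g ((univ K).a .ε) * (univ K).a .ξ) := by
    rw [← sub_zero (_ + _), ← h]
    simp only [branchDefect_apply, hochschildD1_apply]
    abel
  rw [invariants_apply, h']
  simp only [hochschildD1_apply, (univ K).rel1, (univ K).rel2, (univ K).rel3, map_zero, sub_zero]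
  refine Prod.ext (by simp) (Prod.ext (by simp) ?_)
  exact tr_commutators fun _ _ a => g ((univ K).a a)

theorem hochschildB2_le_ker_invariants :
    hochschildB2 K (PreprojectiveD4 K) ≤ LinearMap.ker invariants := by
  rintro _ ⟨g, rfl⟩
  exact invariants_hochschildD1 g

/-! ### Three deformations -/

theorem tr_e (x : D4Vertex) : tr ((univ K).e x) = 0 := by
  have h : (univ K).e x = (univ K).path [.vertex x] := by simp [Rep.path, Rep.gen]
  rw [h, tr_path, ← Nat.cast_zero]
  apply natCast_eq_natCast_of_mod_two
  clear h
  revert x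
  decide +kernel

theorem tr_βαδγ :
    tr ((univ K).a .β * ((univ K).a .α * ((univ K).a .δ * (univ K).a .γ))) = 1 := by
  have h : (univ K).a .β * ((univ K).a .α * ((univ K).a .δ * (univ K).a .γ)) =
      (univ K).path (basisPath 27) := by simp [Rep.path, basisPath, Rep.gen]
  rw [h, tr_path, ← Nat.cast_one]
  apply natCast_eq_natCast_of_mod_two
  decide +kernel

/-- The deformation `αβ = t`, `ξε = t`, `γδ = t`. -/
def leafColumns : ∀ {x y : D4Vertex}, D4Arrow x y → Fin 28 → List (Fin 28)
  | _, _, .α => columns [(0, 19)]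
  | _, _, .β => columns [(18, 1), (20, 2), (21, 3), (23, 4), (24, 5)]
  | _, _, .γ => columns [(12, 20), (15, 26)]
  | _, _, .δ => columns [(18, 13), (19, 14), (22, 16), (25, 17)]
  | _, _, .ε => columns [(22, 10), (26, 11)]
  | _, _, .ξ => columns [(6, 21), (7, 23), (8, 24), (9, 25)]

/-- The deformation `βα + δγ + εξ = t`. -/
def branchColumns : ∀ {x y : D4Vertex}, D4Arrow x y → Fin 28 → List (Fin 28)
  | _, _, .α => columns []
  | _, _, .β => columns []
  | _, _, .γ => columns [(15, 26)]
  | _, _, .δ => columns [(21, 15)]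
  | _, _, .ε => columns [(18, 7), (19, 8), (20, 9), (22, 10)]
  | _, _, .ξ => columns [(7, 23), (8, 24), (9, 25), (10, 27)]

/-- The deformation `βα + δγ + εξ = tβαδγ`. -/
def socleColumns : ∀ {x y : D4Vertex}, D4Arrow x y → Fin 28 → List (Fin 28)
  | _, _, .ε => columns [(27, 7)]
  | _, _, _ => columns []

/-- A deformation of the left regular representation gives rise to a cocycle. -/
theorem exists_cocycle_of_columns
    (c : ∀ {x y : D4Vertex}, D4Arrow x y → Fin 28 → List (Fin 28))
    (origin : ∀ {x y : D4Vertex} (a : D4Arrow x y),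
      sparse K (vertexColumns x) * sparse K (c a) = sparse K (c a))
    (terminus : ∀ {x y : D4Vertex} (a : D4Arrow x y),
      sparse K (c a) * sparse K (vertexColumns y) = sparse K (c a))
    (r₁ r₂ r₃ r₄ : PreprojectiveD4 K)
    (h₁ : sparse K (arrowColumns .α) * sparse K (c .β) +
      sparse K (c .α) * sparse K (arrowColumns .β) = (regular K).lift r₁)
    (h₂ : sparse K (arrowColumns .ξ) * sparse K (c .ε) +
      sparse K (c .ξ) * sparse K (arrowColumns .ε) = (regular K).lift r₂)
    (h₃ : sparse K (arrowColumns .γ) * sparse K (c .δ) +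
      sparse K (c .γ) * sparse K (arrowColumns .δ) = (regular K).lift r₃)
    (h₄ : sparse K (arrowColumns .β) * sparse K (c .α) +
      sparse K (c .β) * sparse K (arrowColumns .α) +
      (sparse K (arrowColumns .δ) * sparse K (c .γ) +
      sparse K (c .δ) * sparse K (arrowColumns .γ)) +
      (sparse K (arrowColumns .ε) * sparse K (c .ξ) +
      sparse K (c .ε) * sparse K (arrowColumns .ξ)) = (regular K).lift r₄) :
    ∃ f ∈ hochschildZ2 K (PreprojectiveD4 K),
      invariants f = (character .v1 r₁, character .v4 r₄, tr (r₁ + r₂ + r₃ + r₄)) := by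
  have he : ∀ x, (regular K).lift ((univ K).e x) = sparse K (vertexColumns x) :=
    fun x => Rep.lift_e _ x
  have ha : ∀ {x y : D4Vertex} (a : D4Arrow x y),
      (regular K).lift ((univ K).a a) = sparse K (arrowColumns a) := fun a => Rep.lift_a _ a
  obtain ⟨f, hf, u, g₁, g₂, g₃, g₄⟩ := exists_cocycle (regular K).lift regular_lift_injective
    (fun a => sparse K (c a)) (fun a => by rw [he, origin]) (fun a => by rw [he, terminus])
    r₁ r₂ r₃ r₄ (by simpa only [ha] using h₁) (by simpa only [ha] using h₂)
    (by simpa only [ha] using h₃) (by simpa only [ha] using h₄)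
  refine ⟨f, hf, ?_⟩
  rw [← branchDefect_apply] at g₄
  rw [invariants_apply, g₁, g₂, g₃, g₄]
  -- The characters kill the terms in u because each has an arrow as a factor; the trace of their
  -- sum vanishes by `tr_commutators`.
  refine Prod.ext (by simp) (Prod.ext (by simp) ?_)
  change tr _ = tr _
  rw [← add_zero (tr (r₁ + r₂ + r₃ + r₄)), ← tr_commutators u, ← map_add]
  congr 1
  abel

/-- The three leaf relations must be deformed with the same coefficient, since `defect_identity`
excludes any other choice of unit parts. -/
theorem exists_leaf_cocycle :
    ∃ f ∈ hochschildZ2 K (PreprojectiveD4 K), invariants f = (1, 0, 0) := by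
  have he : ∀ x, (regular K).lift ((univ K).e x) = sparse K (vertexColumns x) :=
    fun x => Rep.lift_e _ x
  obtain ⟨f, hf, h⟩ := exists_cocycle_of_columns (K := K) leafColumns
    (fun a => by rw [sparse_mul]; refine sparse_congr ?_; cases a <;> decide +kernel)
    (fun a => by rw [sparse_mul]; refine sparse_congr ?_; cases a <;> decide +kernel)
    ((univ K).e .v1) ((univ K).e .v2) ((univ K).e .v3) 0
    (by simp only [he, sparse_mul, sparse_add]; refine sparse_congr ?_; decide +kernel)
    (by simp only [he, sparse_mul, sparse_add]; refine sparse_congr ?_; decide +kernel)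
    (by simp only [he, sparse_mul, sparse_add]; refine sparse_congr ?_; decide +kernel)
    (by simp only [map_zero, sparse_mul, sparse_add]; refine sparse_eq_zero ?_; decide +kernel)
  exact ⟨f, hf, by simp [h, tr_e]⟩

theorem exists_branch_cocycle :
    ∃ f ∈ hochschildZ2 K (PreprojectiveD4 K), invariants f = (0, 1, 0) := by
  have he : ∀ x, (regular K).lift ((univ K).e x) = sparse K (vertexColumns x) :=
    fun x => Rep.lift_e _ x
  obtain ⟨f, hf, h⟩ := exists_cocycle_of_columns (K := K) branchColumns
    (fun a => by rw [sparse_mul]; refine sparse_congr ?_; cases a <;> decide +kernel)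
    (fun a => by rw [sparse_mul]; refine sparse_congr ?_; cases a <;> decide +kernel)
    0 0 0 ((univ K).e .v4)
    (by simp only [map_zero, sparse_mul, sparse_add]; refine sparse_eq_zero ?_; decide +kernel)
    (by simp only [map_zero, sparse_mul, sparse_add]; refine sparse_eq_zero ?_; decide +kernel)
    (by simp only [map_zero, sparse_mul, sparse_add]; refine sparse_eq_zero ?_; decide +kernel)
    (by simp only [he, sparse_mul, sparse_add]; refine sparse_congr ?_; decide +kernel)
  exact ⟨f, hf, by simp [h, tr_e]⟩

theorem exists_socle_cocycle :
    ∃ f ∈ hochschildZ2 K (PreprojectiveD4 K), invariants f = (0, 0, 1) := by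
  have ha : ∀ {x y : D4Vertex} (a : D4Arrow x y),
      (regular K).lift ((univ K).a a) = sparse K (arrowColumns a) := fun a => Rep.lift_a _ a
  obtain ⟨f, hf, h⟩ := exists_cocycle_of_columns (K := K) socleColumns
    (fun a => by rw [sparse_mul]; refine sparse_congr ?_; cases a <;> decide +kernel)
    (fun a => by rw [sparse_mul]; refine sparse_congr ?_; cases a <;> decide +kernel)
    0 0 0 ((univ K).a .β * ((univ K).a .α * ((univ K).a .δ * (univ K).a .γ)))
    (by simp only [map_zero, sparse_mul, sparse_add]; refine sparse_eq_zero ?_; decide +kernel)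
    (by simp only [map_zero, sparse_mul, sparse_add]; refine sparse_eq_zero ?_; decide +kernel)
    (by simp only [map_zero, sparse_mul, sparse_add]; refine sparse_eq_zero ?_; decide +kernel)
    (by simp only [map_mul, ha, sparse_mul, sparse_add]; refine sparse_congr ?_; decide +kernel)
  exact ⟨f, hf, by simp [h, tr_βαδγ]⟩

theorem exists_cocycle_invariants_eq (v : K × K × K) :
    ∃ f ∈ hochschildZ2 K (PreprojectiveD4 K), invariants f = v := by
  obtain ⟨f, hf, h⟩ := exists_leaf_cocycle (K := K)
  obtain ⟨f', hf', h'⟩ := exists_branch_cocycle (K := K)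
  obtain ⟨f'', hf'', h''⟩ := exists_socle_cocycle (K := K)
  refine ⟨v.1 • f + v.2.1 • f' + v.2.2 • f'', add_mem (add_mem (Submodule.smul_mem _ _ hf)
    (Submodule.smul_mem _ _ hf')) (Submodule.smul_mem _ _ hf''), ?_⟩
  simp [h, h', h'']

end PreprojectiveD4

/-! ### The square-zero extension of a Hochschild cocycle -/

section SquareZero

variable {K : Type u} [Field K] {A : Type v} [Ring A] [Algebra K A]

/-- The square-zero extension of an algebra by itself that is defined by a Hochschild cocycle. -/
def CocycleExtension (_ : hochschildZ2 K A) : Type v := A × A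

namespace CocycleExtension

variable {f : hochschildZ2 K A}

theorem cocycle (f : hochschildZ2 K A) (a b c : A) : a * f.1 (b ⊗ₜ c) - f.1 ((a * b) ⊗ₜ c) +
    f.1 (a ⊗ₜ (b * c)) - f.1 (a ⊗ₜ b) * c = 0 :=
  f.2 a b c

theorem cocycle_one_left (f : hochschildZ2 K A) (a : A) : f.1 (1 ⊗ₜ a) = f.1 (1 ⊗ₜ 1) * a := by
  have h := cocycle f 1 1 a
  simpa [sub_eq_zero] using h

theorem cocycle_one_right (f : hochschildZ2 K A) (a : A) : f.1 (a ⊗ₜ 1) = a * f.1 (1 ⊗ₜ 1) := by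
  have h := cocycle f a 1 1
  simp only [mul_one, sub_add_cancel] at h
  exact (sub_eq_zero.mp h).symm

noncomputable instance : AddCommGroup (CocycleExtension f) := inferInstanceAs (AddCommGroup (A × A))

noncomputable instance : Module K (CocycleExtension f) := inferInstanceAs (Module K (A × A))

/-- The element of the extension with given components. -/
def mk (a x : A) : CocycleExtension f := (a, x)

/-- The component in the quotient. -/
def fst (p : CocycleExtension f) : A := p.1

/-- The component in the square-zero ideal. -/
def snd (p : CocycleExtension f) : A := p.2

@[ext]
theorem ext {p q : CocycleExtension f} (h : p.fst = q.fst) (h' : p.snd = q.snd) : p = q :=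
  Prod.ext h h'

noncomputable instance : Mul (CocycleExtension f) :=
  ⟨fun p q => mk (p.fst * q.fst) (p.fst * q.snd + p.snd * q.fst + f.1 (p.fst ⊗ₜ q.fst))⟩

/-- The cocycle need not be normalized, so the unit carries the correction -f(1 ⊗ 1). -/
noncomputable instance : One (CocycleExtension f) := ⟨mk 1 (-f.1 (1 ⊗ₜ 1))⟩

@[simp] theorem fst_mk (a x : A) : (mk a x : CocycleExtension f).fst = a := rfl
@[simp] theorem snd_mk (a x : A) : (mk a x : CocycleExtension f).snd = x := rfl
@[simp] theorem fst_zero : (0 : CocycleExtension f).fst = 0 := rfl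
@[simp] theorem snd_zero : (0 : CocycleExtension f).snd = 0 := rfl
@[simp] theorem fst_one : (1 : CocycleExtension f).fst = 1 := rfl
@[simp] theorem snd_one : (1 : CocycleExtension f).snd = -f.1 (1 ⊗ₜ 1) := rfl
@[simp] theorem fst_add (p q : CocycleExtension f) : (p + q).fst = p.fst + q.fst := rfl
@[simp] theorem snd_add (p q : CocycleExtension f) : (p + q).snd = p.snd + q.snd := rfl
@[simp] theorem fst_smul (r : K) (p : CocycleExtension f) : (r • p).fst = r • p.fst := rfl
@[simp] theorem snd_smul (r : K) (p : CocycleExtension f) : (r • p).snd = r • p.snd := rfl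
@[simp] theorem fst_mul (p q : CocycleExtension f) : (p * q).fst = p.fst * q.fst := rfl
@[simp] theorem snd_mul (p q : CocycleExtension f) : (p * q).snd =
    p.fst * q.snd + p.snd * q.fst + f.1 (p.fst ⊗ₜ q.fst) := rfl

noncomputable instance : Ring (CocycleExtension f) where
  __ := (inferInstance : AddCommGroup (CocycleExtension f))
  one_mul p := by ext <;> simp [cocycle_one_left f p.fst]
  mul_one p := by ext <;> simp [cocycle_one_right f p.fst]
  zero_mul p := by ext <;> simp
  mul_zero p := by ext <;> simp
  left_distrib p q r := by
    ext
    · simp [mul_add]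
    · simp only [snd_mul, snd_add, fst_add, mul_add, TensorProduct.tmul_add, map_add]; abel
  right_distrib p q r := by
    ext
    · simp [add_mul]
    · simp only [snd_mul, snd_add, fst_add, add_mul, TensorProduct.add_tmul, map_add]; abel
  mul_assoc p q r := by
    ext
    · simp [mul_assoc]
    -- The second component of the associator is minus the cocycle expression.
    · rw [← sub_eq_zero, ← neg_eq_zero, ← cocycle f p.fst q.fst r.fst]
      simp only [snd_mul, fst_mul]
      noncomm_ring

noncomputable instance : Algebra K (CocycleExtension f) :=
  Algebra.ofModule
    (fun r p q => by
      ext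
      · simp
      · simp [← TensorProduct.smul_tmul'])
    (fun r p q => by
      ext
      · simp
      · simp)

/-- The projection from the extension. -/
noncomputable def fstHom (f : hochschildZ2 K A) : CocycleExtension f →ₐ[K] A :=
  AlgHom.ofLinearMap (⟨⟨fst, fst_add⟩, fst_smul⟩ : CocycleExtension f →ₗ[K] A) rfl fun _ _ => rfl

/-- A cocycle is a coboundary if its extension splits. -/
theorem mem_hochschildB2_of_splits (θ : A →ₐ[K] CocycleExtension f)
    (h : (fstHom f).comp θ = AlgHom.id K A) : f.1 ∈ hochschildB2 K A := by
  have hfst : ∀ a, (θ a).fst = a := fun a => DFunLike.congr_fun h a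
  let g : A →ₗ[K] A := (⟨⟨snd, snd_add⟩, snd_smul⟩ : CocycleExtension f →ₗ[K] A) ∘ₗ θ.toLinearMap
  have hg : ∀ a, g a = (θ a).snd := fun _ => rfl
  -- With θ a = (a, g a), multiplicativity reads g(ab) = a g(b) + g(a) b + f(a ⊗ b), so f is the
  -- differential of -g.
  refine ⟨-g, ?_⟩
  ext a b
  have hmul := congrArg snd (map_mul θ a b)
  rw [snd_mul, hfst, hfst, ← hg, ← hg, ← hg] at hmul
  simp only [TensorProduct.AlgebraTensorModule.curry_apply, LinearMap.restrictScalars_self,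
    TensorProduct.curry_apply, hochschildD1_apply, LinearMap.neg_apply, hmul]
  noncomm_ring

/-- The element `a` of the algebra, in the extension. -/
def sec (f : hochschildZ2 K A) (a : A) : CocycleExtension f := mk a 0

/-- The element `x` of the square-zero ideal. -/
def inr (f : hochschildZ2 K A) (x : A) : CocycleExtension f := mk 0 x

theorem sec_mul_sec (a b : A) : sec f a * sec f b = sec f (a * b) + inr f (f.1 (a ⊗ₜ b)) := by
  ext <;> simp [sec, inr]

theorem sec_zero : sec f 0 = 0 := rfl

theorem sec_mul_inr (a x : A) : sec f a * inr f x = inr f (a * x) := by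
  ext <;> simp [sec, inr]

theorem inr_mul_sec (x a : A) : inr f x * sec f a = inr f (x * a) := by
  ext <;> simp [sec, inr]

theorem inr_mul_inr (x y : A) : inr f x * inr f y = 0 := by
  ext <;> simp [inr]

theorem sec_add (a b : A) : sec f (a + b) = sec f a + sec f b := by
  ext <;> simp [sec]

theorem inr_add (a b : A) : inr f (a + b) = inr f a + inr f b := by
  ext <;> simp [inr]

theorem inr_injective : Function.Injective (inr f) := fun _ _ h => congrArg snd h

theorem inr_neg (x : A) : inr f (-x) = -inr f x := by
  rw [eq_neg_iff_add_eq_zero, ← inr_add, neg_add_cancel]; rfl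

end CocycleExtension

/-! ### Relations between defects, and normalization -/

open CocycleExtension

/-- The left side is a(ex)(ex)b; substitute ex = R - ba - dc in both factors and expand. When ab,
cd, xe and R lie in a square-zero ideal, only the terms with a single such factor survive. -/
theorem mesh_identity {E : Type w} [Ring E] (a b c d e x R : E)
    (hR : R = b * a + d * c + e * x) :
    a * (e * ((x * e) * x * b)) = a * (R * R) * b - a * (R * (b * (a * b))) - a * (R * d * c * b) -
      (a * b) * a * R * b + (a * b) * (a * b) * (a * b) + (a * b) * a * d * c * b -
      a * (d * (c * (R * b))) + a * (d * (c * (b * (a * b)))) +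
      a * (d * ((c * d) * c * b)) := by
  rw [hR]
  noncomm_ring

/-- The condition that a cocycle imposes on the defects of the relations of the preprojective
algebra of type `D₄`. -/
theorem defect_identity (f : hochschildZ2 K A) {a b c d e x r : A} (hab : a * b = 0)
    (hcd : c * d = 0) (hxe : x * e = 0) (hsum : b * a + d * c + e * x = 0)
    (hr : r = f.1 (b ⊗ₜ a) + f.1 (d ⊗ₜ c) + f.1 (e ⊗ₜ x)) :
    a * (e * (f.1 (x ⊗ₜ e) * x * b)) = -(a * (r * d * c * b)) +
      f.1 (a ⊗ₜ b) * a * d * c * b - a * (d * (c * (r * b))) +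
      a * (d * (c * (b * f.1 (a ⊗ₜ b)))) + a * (d * (f.1 (c ⊗ₜ d) * c * b)) := by
  have hR : inr f r = sec f b * sec f a + sec f d * sec f c + sec f e * sec f x := by
    have h : sec f (b * a) + sec f (d * c) + sec f (e * x) = 0 := by
      rw [← sec_add, ← sec_add, hsum, sec_zero]
    rw [hr, inr_add, inr_add, sec_mul_sec, sec_mul_sec, sec_mul_sec, ← zero_add (_ + _), ← h]
    abel
  have h := mesh_identity (sec f a) (sec f b) (sec f c) (sec f d) (sec f e) (sec f x) _ hR
  rw [sec_mul_sec a b, sec_mul_sec c d, sec_mul_sec x e, hab, hcd, hxe, sec_zero, zero_add,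
    zero_add, zero_add] at h
  simp only [sec_mul_inr, inr_mul_sec, inr_mul_inr, mul_zero, zero_mul, sub_zero, zero_sub,
    add_zero] at h
  simp only [← inr_neg, ← inr_add, sub_eq_add_neg] at h
  rw [inr_injective h, sub_eq_add_neg]

/-- Every cocycle is cohomologous to one that is normalized with respect to a complete family of
orthogonal idempotents. -/
theorem exists_normalized {ι : Type*} [Fintype ι] (e : ι → A) (idem : ∀ i, e i * e i = e i)
    (orth : ∀ i j, i ≠ j → e i * e j = 0) (sum_eq_one : ∑ i, e i = 1)
    {f : A ⊗[K] A →ₗ[K] A} (hf : f ∈ hochschildZ2 K A) :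
    ∃ f' ∈ hochschildZ2 K A, f - f' ∈ hochschildB2 K A ∧
      (∀ i a, f' (e i ⊗ₜ a) = 0) ∧ ∀ a i, f' (a ⊗ₜ e i) = 0 := by
  classical
  have left : ∀ f ∈ hochschildZ2 K A, ∃ f' ∈ hochschildZ2 K A, f - f' ∈ hochschildB2 K A ∧
      ∀ i a, f' (e i ⊗ₜ a) = 0 := by
    intro f hf
    -- The contracting homotopy given by the separability idempotent ∑ eᵢ ⊗ eᵢ of the subalgebra
    -- spanned by the eᵢ.
    let h : A →ₗ[K] A := ∑ i, LinearMap.mulLeft K (e i) ∘ₗ f ∘ₗ TensorProduct.mk K A A (e i)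
    have hh : ∀ a, h a = ∑ i, e i * f (e i ⊗ₜ a) := fun a => by simp [h]
    refine ⟨f - hochschildD1 K A h, sub_mem hf (hochschildB2_le_Z2 K A ⟨h, rfl⟩), ?_, ?_⟩
    · rw [sub_sub_cancel]; exact ⟨h, rfl⟩
    · intro j a
      -- The cocycle condition at (eᵢ, eⱼ, a), multiplied by eᵢ and summed over i.
      have h₁ : ∑ i, e i * (e i * f (e j ⊗ₜ a) - f ((e i * e j) ⊗ₜ a) + f (e i ⊗ₜ (e j * a)) -
          f (e i ⊗ₜ e j) * a) = 0 :=
        Finset.sum_eq_zero fun i _ => by rw [hf, mul_zero]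
      have h₂ : ∑ i, e i * f ((e i * e j) ⊗ₜ a) = e j * f (e j ⊗ₜ a) := by
        rw [Finset.sum_eq_single j, idem]
        · intro i _ hi
          rw [orth i j hi, TensorProduct.zero_tmul, map_zero, mul_zero]
        · simp
      have h₃ : e j * h a = e j * f (e j ⊗ₜ a) := by
        rw [hh, Finset.mul_sum, Finset.sum_eq_single j, ← mul_assoc, idem]
        · intro i _ hi
          rw [← mul_assoc, orth j i hi.symm, zero_mul]
        · simp
      simp only [mul_sub, mul_add, Finset.sum_sub_distrib, Finset.sum_add_distrib, h₂] at h₁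
      simp only [← mul_assoc, idem, ← Finset.sum_mul, sum_eq_one, one_mul] at h₁
      rw [LinearMap.sub_apply, hochschildD1_apply, h₃, hh, hh, ← h₁, Finset.sum_mul]
      abel
  obtain ⟨f₁, hf₁, hd₁, hl₁⟩ := left f hf
  have hmul : ∀ j a b, f₁ ((e j * a) ⊗ₜ b) = e j * f₁ (a ⊗ₜ b) := by
    intro j a b
    have := hf₁ (e j) a b
    rw [hl₁, hl₁, zero_mul, sub_zero, add_zero, sub_eq_zero] at this
    exact this.symm
  let h : A →ₗ[K] A :=
    ∑ i, LinearMap.mulRight K (e i) ∘ₗ f₁ ∘ₗ (TensorProduct.mk K A A).flip (e i)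
  have hh : ∀ a, h a = ∑ i, f₁ (a ⊗ₜ e i) * e i := fun a => by simp [h]
  refine ⟨f₁ - hochschildD1 K A h, sub_mem hf₁ (hochschildB2_le_Z2 K A ⟨h, rfl⟩), ?_, ?_, ?_⟩
  · rw [← sub_add]; exact add_mem hd₁ ⟨h, rfl⟩
  -- The correction on the right preserves the normalization on the left, because h kills each eⱼ
  -- and commutes with left multiplication by it.
  · intro j a
    have h₁ : h (e j) = 0 := by simp [hh, hl₁]
    have h₂ : h (e j * a) = e j * h a := by simp [hh, hmul, Finset.mul_sum, mul_assoc]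
    rw [LinearMap.sub_apply, hochschildD1_apply, h₁, h₂, hl₁]
    simp
  · intro a j
    have h₁ : ∑ i, (a * f₁ (e j ⊗ₜ e i) - f₁ ((a * e j) ⊗ₜ e i) + f₁ (a ⊗ₜ (e j * e i)) -
        f₁ (a ⊗ₜ e j) * e i) * e i = 0 :=
      Finset.sum_eq_zero fun i _ => by rw [hf₁, zero_mul]
    have h₂ : ∑ i, f₁ (a ⊗ₜ (e j * e i)) * e i = f₁ (a ⊗ₜ e j) * e j := by
      rw [Finset.sum_eq_single j, idem]
      · intro i _ hi
        rw [orth j i hi.symm, TensorProduct.tmul_zero, map_zero, zero_mul]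
      · simp
    have h₃ : h a * e j = f₁ (a ⊗ₜ e j) * e j := by
      rw [hh, Finset.sum_mul, Finset.sum_eq_single j, mul_assoc, idem]
      · intro i _ hi
        rw [mul_assoc, orth i j hi, mul_zero]
      · simp
    have h₄ : h (e j) = 0 := by simp [hh, hl₁]
    simp only [sub_mul, add_mul, Finset.sum_sub_distrib, Finset.sum_add_distrib, h₂, hl₁] at h₁
    simp only [mul_assoc, idem, ← Finset.mul_sum, sum_eq_one, mul_one, mul_zero, zero_mul,
      Finset.sum_const_zero] at h₁
    rw [LinearMap.sub_apply, hochschildD1_apply, h₃, h₄, hh, mul_zero]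
    refine Eq.trans ?_ (neg_eq_zero.mpr h₁)
    abel

end SquareZero

/-! ### Splitting the extension of a cocycle with vanishing invariants -/

namespace PreprojectiveD4

open CocycleExtension

variable {K : Type u} [Field K]

/-- The correction of the lifts of the arrows to the extension of a cocycle. -/
noncomputable def correction (p q s₁ s₂ s₃ : K) :
    ∀ {x y : D4Vertex}, D4Arrow x y → PreprojectiveD4 K
  | _, _, .α => p • (univ K).a .α + s₁ • ((univ K).a .α * ((univ K).a .δ * (univ K).a .γ))
  | _, _, .γ => q • (univ K).a .γ + s₃ • ((univ K).a .γ * ((univ K).a .β * (univ K).a .α))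
  | _, _, .ξ => s₂ • ((univ K).a .ξ * ((univ K).a .β * (univ K).a .α))
  | _, _, _ => 0

variable [CharP K 2]

theorem tr_basisPath (i : Fin 28) : tr ((univ K).path (basisPath i)) =
    if i ∈ ({5, 11, 17, 27} : Finset (Fin 28)) then 1 else 0 := by
  rw [tr_path, ← Nat.cast_one, ← Nat.cast_zero, ← Nat.cast_ite]
  apply natCast_eq_natCast_of_mod_two
  revert i
  decide +kernel

theorem tr_αδγβ :
    tr ((univ K).a .α * ((univ K).a .δ * ((univ K).a .γ * (univ K).a .β))) = 1 := by
  simpa [Rep.path, basisPath, Rep.gen] using tr_basisPath (K := K) 5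

theorem tr_ξβαε :
    tr ((univ K).a .ξ * ((univ K).a .β * ((univ K).a .α * (univ K).a .ε))) = 1 := by
  simpa [Rep.path, basisPath, Rep.gen] using tr_basisPath (K := K) 11

theorem tr_γβαδ :
    tr ((univ K).a .γ * ((univ K).a .β * ((univ K).a .α * (univ K).a .δ))) = 1 := by
  simpa [Rep.path, basisPath, Rep.gen] using tr_basisPath (K := K) 17

theorem tr_βα : tr ((univ K).a .β * (univ K).a .α) = 0 := by
  simpa [Rep.path, basisPath, Rep.gen] using tr_basisPath (K := K) 22

theorem tr_δγ : tr ((univ K).a .δ * (univ K).a .γ) = 0 := by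
  simpa [Rep.path, basisPath, Rep.gen] using tr_basisPath (K := K) 23

/-- A normalized cocycle without invariants is a coboundary. -/
theorem mem_hochschildB2_of_normalized (f : hochschildZ2 K (PreprojectiveD4 K))
    (hl : ∀ x a, f.1 ((univ K).e x ⊗ₜ a) = 0) (hr : ∀ a x, f.1 (a ⊗ₜ (univ K).e x) = 0)
    (hf : invariants f.1 = 0) : f.1 ∈ hochschildB2 K (PreprojectiveD4 K) := by
  -- Normalization makes f linear over the trivial paths in its outer arguments, so the defects lie
  -- in corners.
  have e_mul : ∀ x a b, (univ K).e x * f.1 (a ⊗ₜ b) = f.1 (((univ K).e x * a) ⊗ₜ b) := by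
    intro x a b
    have h := cocycle f ((univ K).e x) a b
    rwa [hl, hl, zero_mul, sub_zero, add_zero, sub_eq_zero] at h
  have mul_e : ∀ x a b, f.1 (a ⊗ₜ b) * (univ K).e x = f.1 (a ⊗ₜ (b * (univ K).e x)) := by
    intro x a b
    have h := cocycle f a b ((univ K).e x)
    rw [hr, hr, mul_zero, zero_sub, neg_zero, zero_add, sub_eq_zero] at h
    exact h.symm
  have left : ∀ {x y z w : D4Vertex} (a : D4Arrow x y) (b : D4Arrow z w),
      (univ K).e x * f.1 ((univ K).a a ⊗ₜ (univ K).a b) =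
        f.1 ((univ K).a a ⊗ₜ (univ K).a b) := fun a b => by rw [e_mul, (univ K).origin]
  have right : ∀ {x y z w : D4Vertex} (a : D4Arrow x y) (b : D4Arrow z w),
      f.1 ((univ K).a a ⊗ₜ (univ K).a b) * (univ K).e w =
        f.1 ((univ K).a a ⊗ₜ (univ K).a b) := fun a b => by rw [mul_e, (univ K).terminus]
  obtain ⟨l₁, s₁, h₁⟩ := corner_v1 _ (left .α .β) (right .α .β)
  obtain ⟨l₂, s₂, h₂⟩ := corner_v2 _ (left .ξ .ε) (right .ξ .ε)
  obtain ⟨l₃, s₃, h₃⟩ := corner_v3 _ (left .γ .δ) (right .γ .δ)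
  obtain ⟨l₄, p, q, s₄, h₄⟩ := corner_v4 (branchDefect f.1)
    (by simp only [branchDefect_apply, mul_add, left])
    (by simp only [branchDefect_apply, add_mul, right])
  -- The defect identity is a relation between multiples of αδγβ, namely l₂ = l₃ + 2l₁ - 2l₄; the
  -- trace extracts the coefficient.
  have hl₃ : l₂ = l₃ := by
    have h := congrArg tr (defect_identity f (univ K).rel1 (univ K).rel3 (univ K).rel2
      (univ K).rel4 (branchDefect_apply f.1))
    rw [h₁, h₂, h₃, h₄] at h
    simp [mul_add, add_mul, mul_assoc, (univ K).e_mul_a, (univ K).a_mul_e,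
      (univ K).rel1, (univ K).rel3, (univ K).rel3',
      (univ K).ε_mul_ξ_mul, (univ K).δγβα_mul, (univ K).βαδγβ, tr_αδγβ] at h
    linear_combination h + (l₁ - l₄) * CharTwo.two_eq_zero (R := K)
  -- The same identity with vertices 1 and 3 exchanged.
  have hl₁ : l₂ = l₁ := by
    have h := congrArg tr (defect_identity f (univ K).rel3 (univ K).rel1 (univ K).rel2
      (r := branchDefect f.1) (by rw [add_comm ((univ K).a .δ * _), (univ K).rel4])
      (by rw [branchDefect_apply, add_comm (f.1 ((univ K).a .δ ⊗ₜ _))]))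
    rw [h₁, h₂, h₃, h₄] at h
    simp [mul_add, add_mul, mul_assoc, (univ K).e_mul_a, (univ K).a_mul_e,
      (univ K).rel1, (univ K).rel3, (univ K).rel1',
      (univ K).ε_mul_ξ_mul, (univ K).δγβα_mul, (univ K).βαδγβ, tr_γβαδ] at h
    linear_combination h + (l₃ - l₄) * CharTwo.two_eq_zero (R := K)
  rw [invariants_apply, h₁, h₂, h₃, h₄] at hf
  simp [Prod.ext_iff, tr_e, tr_αδγβ, tr_ξβαε, tr_γβαδ, tr_βα, tr_δγ, tr_βαδγ] at hf
  obtain ⟨rfl, rfl, hs⟩ := hf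
  subst hl₁ hl₃
  rw [zero_smul, zero_add] at h₁ h₂ h₃
  rw [zero_smul, zero_add] at h₄
  have hs₄ : s₄ = s₁ + s₂ + s₃ := (CharTwo.add_eq_zero.mp hs).symm
  -- The multiples of α and γ remove p and q from the branch defect and do not disturb αβ = 0 or γδ
  -- = 0. The terms of length 3 remove s₁, s₂, s₃ from the leaf defects; each adds its coefficient
  -- times βαδγ at the branch vertex, which cancels s₄ because s₄ = s₁ + s₂ + s₃.
  let v : ∀ {x y : D4Vertex}, D4Arrow x y → PreprojectiveD4 K := correction p q s₁ s₂ s₃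
  let R : Rep (CocycleExtension f) :=
    { e := fun x => mk ((univ K).e x) 0
      a := fun a => mk ((univ K).a a) (v a)
      idem := fun x => by ext <;> simp [(univ K).idem, hl]
      orth := fun x y h => by ext <;> simp [(univ K).orth x y h, hl]
      sum_eq_one := by
        have h : ∀ s : Finset D4Vertex, ∑ x ∈ s, (mk ((univ K).e x) 0 : CocycleExtension f) =
            mk (∑ x ∈ s, (univ K).e x) 0 := fun s => by
          induction s using Finset.cons_induction with
          | empty => rfl
          | cons x s hx ih =>
            rw [Finset.sum_cons, Finset.sum_cons, ih]
            ext <;> simp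
        rw [h, (univ K).sum_eq_one]
        ext
        · rfl
        · rw [snd_mk, snd_one, ← (univ K).sum_eq_one, TensorProduct.sum_tmul, map_sum]
          simp [hl]
      origin := fun a => by
        ext
        · exact (univ K).origin a
        · cases a <;> simp [v, correction, mul_add, hl, (univ K).e_mul_a, (univ K).e_mul_a_mul]
      terminus := fun a => by
        ext
        · exact (univ K).terminus a
        · cases a <;> simp [v, correction, add_mul, mul_assoc, hr, (univ K).a_mul_e]
      rel1 := by
        ext
        · exact (univ K).rel1
        · simp [v, correction, add_mul, mul_assoc, h₁, (univ K).rel1, CharTwo.add_self_eq_zero]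
      rel2 := by
        ext
        · exact (univ K).rel2
        · simp [v, correction, mul_assoc, h₂, CharTwo.add_self_eq_zero]
      rel3 := by
        ext
        · exact (univ K).rel3
        · simp [v, correction, add_mul, mul_assoc, h₃, (univ K).rel3, CharTwo.add_self_eq_zero]
      rel4 := by
        ext
        · exact (univ K).rel4
        · have h : p • ((univ K).a .β * (univ K).a .α) +
              s₁ • ((univ K).a .β * ((univ K).a .α * ((univ K).a .δ * (univ K).a .γ))) +
              (q • ((univ K).a .δ * (univ K).a .γ) +
              s₃ • ((univ K).a .β * ((univ K).a .α * ((univ K).a .δ * (univ K).a .γ)))) +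
              s₂ • ((univ K).a .β * ((univ K).a .α * ((univ K).a .δ * (univ K).a .γ))) +
              branchDefect f.1 = 0 := by
            rw [h₄, hs₄]
            simp only [add_smul]
            generalize (univ K).a .β * ((univ K).a .α * ((univ K).a .δ * (univ K).a .γ)) = m
            generalize p • ((univ K).a .β * (univ K).a .α) = x₁
            generalize q • ((univ K).a .δ * (univ K).a .γ) = x₂
            generalize s₁ • m = x₃, s₂ • m = x₄, s₃ • m = x₅
            have : ∀ x : PreprojectiveD4 K, x + x = 0 := CharTwo.add_self_eq_zero
            rw [← this (x₁ + x₂ + x₃ + x₄ + x₅)]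
            abel
          rw [snd_zero, ← h, branchDefect_apply]
          simp only [v, correction, snd_add, snd_mul, fst_mk, snd_mk, mul_add, mul_smul_comm,
            zero_mul, (univ K).δγβα, (univ K).ε_mul_ξ_mul, (univ K).rel1', mul_zero, add_zero,
            zero_add]
          abel }
  refine mem_hochschildB2_of_splits R.lift (algHom_ext fun g => ?_)
  rw [AlgHom.comp_apply, Rep.lift_gen]
  cases g <;> rfl

theorem ker_invariants_inf_le {f : PreprojectiveD4 K ⊗[K] PreprojectiveD4 K →ₗ[K] PreprojectiveD4 K}
    (hf : f ∈ hochschildZ2 K (PreprojectiveD4 K)) (h : invariants f = 0) :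
    f ∈ hochschildB2 K (PreprojectiveD4 K) := by
  obtain ⟨f', hf', hd, hl, hr⟩ := exists_normalized (univ K).e (univ K).idem (univ K).orth
    (univ K).sum_eq_one hf
  have h' : invariants (f - f') = 0 := hochschildB2_le_ker_invariants hd
  rw [map_sub, h, zero_sub, neg_eq_zero] at h'
  have := add_mem hd (mem_hochschildB2_of_normalized ⟨f', hf'⟩ hl hr h')
  rwa [sub_add_cancel] at this

/-- The second Hochschild cohomology of the preprojective algebra of type `D₄` in
characteristic `2`. -/
noncomputable def hh2Equiv : HH2 K (PreprojectiveD4 K) ≃ₗ[K] K × K × K :=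
  -- Within the cocycles, the coboundaries are exactly the kernel of the invariants.
  (Submodule.quotEquivOfEq _ _ (by
    ext f
    exact ⟨fun h => hochschildB2_le_ker_invariants h, fun h => ker_invariants_inf_le f.2 h⟩)).trans
  ((invariants.domRestrict (hochschildZ2 K (PreprojectiveD4 K))).quotKerEquivOfSurjective fun v => by
    obtain ⟨f, hf, h⟩ := exists_cocycle_invariants_eq v
    exact ⟨⟨f, hf⟩, h⟩)

end PreprojectiveD4

theorem theorem4p1 (K : Type*) [Field K] [IsAlgClosed K] [CharP K 2] :
    Module.finrank K (HH2 K (PreprojectiveD4 K)) = 3 := by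
  rw [PreprojectiveD4.hh2Equiv.finrank_eq]
  simp
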